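/- Let $\mathbb M$ be a Hausdorff $C^\infty$-manifold of dimension $N$, let $0=\dim H_0<\dim H_1<\dots<\dim H_M=N$ be natural numbers, and let $X_1,\dots,X_N$ be $C^1$-smooth vector fields on an open set $V\subset\mathbb M$ which form a local basis of a Carnot manifold, in the following sense: with $\deg X_k=\min\{m: k\le\dim H_m\}$ (so that $X_k\in H_m=\operatorname{span}\{X_1,\dots,X_{\dim H_m}\}$ exactly for $m\ge\deg X_k$), for each $v\in V$ the vectors $X_1(v),\dots,X_N(v)$ form a basis of $T_v\mathbb M$, and $$[X_i,X_j](v)=\sum_{\deg X_k\le\deg X_i+\deg X_j}c_{ijk}(v)X_k(v)\qquad(1\le i,j\le N)$$ for some real numbers $c_{ijk}(v)$. For $u\in V$ put $\theta_u(\xi)=\exp\bigl(\sum_{i}\xi_iX_i\bigr)(u)$, the time-one value of the integral curve in $V$ of $\sum_i\xi_iX_i$ that starts at $u$. If $v=\theta_u(\xi)$, where $|\xi|<r$ and $\theta_u$ is defined on the Euclidean ball $B_E(0,r)\subset\mathbb R^N$ and is a $C^1$-diffeomorphism of it onto an open set, then $\xi$ (which is unique) is the tuple of normal coordinates of $v$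 with respect to $u$, and $d_\infty(u,v)=\max_i|\xi_i|^{1/\deg X_i}$; put $d_\infty(u,v)=\infty$ if there is no such $\xi$. Let $\operatorname{Box}(u,\varepsilon)=\{y\in\mathbb M: d_\infty(u,y)<\varepsilon\}$, and let $\operatorname{diam}$ denote the diameter with respect to $d_\infty$. Call a set $U\subset V$ normally covered if for each $u\in U$ there is $r_u>0$ such that $\theta_u$ is defined on $B_E(0,r_u)$, is a $C^1$-diffeomorphism of it onto an open set, and $\theta_u(B_E(0,r_u))\supset U$. (On such $U$ the function $d_\infty$ is finite.) Then every point of $V$ has a compact normally covered neighborhood, and for every compact normally covered set $U$: 1. (Estimate of the diameter of a box) there are constants $L\ge 0$ and $\varepsilon_0>0$, independent of the point $u$ and of $\varepsilon$, such that $\operatorname{diam}(\operatorname{Box}(u,\varepsilon))\le L\varepsilon$ for all $u\in U$ and all $0<\varepsilon\le\varepsilon_0$; 2. (Generalized triangle inequality) there is a constant $Q\ge 0$ such that $d_\infty(u,v)\le Q\bigl(d_\infty(u,w)+d_\infty(w,v)\bigr)$ for all $u,v,w\in U$. -/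

import Mathlib

open Set Metric
open scoped Manifold ContDiff Topology ENNReal NNReal

noncomputable section

/-- The finite sequence of dimensions `0 < dim H₁ < ⋯ < dim H_M = N` of a filtration of
an `N`-dimensional tangent bundle; here `M = depth`, `dim H_m = dimH m` for `1 ≤ m ≤ depth`,
and `dimH 0 = 0`. (Values of `dimH` beyond `depth` play no role.) -/
structure FiltrationDims (N : ℕ) where
  depth : ℕ
  dimH : ℕ → ℕ
  dimH_zero : dimH 0 = 0
  dimH_lt : ∀ m < depth, dimH m < dimH (m + 1)
  dimH_depth : dimH depth = N

/-- `deg X_k = min {m | X_k ∈ H_m}`, where `H_m` is spanned by the first `dim H_m` fields.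
The index `k : Fin N` counts from `0`, so `X_k ∈ H_m` means `k < dim H_m`. -/
def FiltrationDims.deg {N : ℕ} (F : FiltrationDims N) (k : Fin N) : ℕ :=
  sInf {m : ℕ | (k : ℕ) < F.dimH m}

/-- The model space `ℝᴺ` with its Euclidean norm. -/
abbrev REuc (N : ℕ) : Type := EuclideanSpace ℝ (Fin N)

/-- The local basis of a Carnot manifold: `X₁, …, X_N` are `C¹` vector fields on the open set `V`
which form a basis of the tangent space at each point of `V`, and
`[X_i, X_j](v) = ∑_{deg X_k ≤ deg X_i + deg X_j} c_{ijk}(v) X_k(v)` for each `v ∈ V`. -/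
structure IsCarnotFrame {N : ℕ} {M : Type*} [TopologicalSpace M] [ChartedSpace (REuc N) M]
    [IsManifold (𝓡 N) ∞ M] (F : FiltrationDims N) (V : Set M)
    (X : Fin N → (x : M) → TangentSpace (𝓡 N) x) : Prop where
  isOpen : IsOpen V
  contMDiffOn : ∀ i, ContMDiffOn (𝓡 N) (𝓡 N).tangent 1
    (fun x => (⟨x, X i x⟩ : TangentBundle (𝓡 N) M)) V
  linearIndependent : ∀ v ∈ V, LinearIndependent ℝ (fun i => X i v)
  span_eq_top : ∀ v ∈ V, Submodule.span ℝ (Set.range fun i => X i v) = ⊤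
  bracket : ∀ i j, ∀ v ∈ V, ∃ c : Fin N → ℝ,
    VectorField.mlieBracket (𝓡 N) (X i) (X j) v
      = ∑ k with F.deg k ≤ F.deg i + F.deg j, c k • X k v

section Distance

variable {N : ℕ} {M : Type*} [TopologicalSpace M] [ChartedSpace (REuc N) M]

/-- `v = exp (∑ ξ_i X_i) (u)`: the integral curve of `∑ ξ_i X_i` that starts at `u` exists in `V`
for times in `[0,1]` and is at `v` at time `1`. -/
def IsExp (V : Set M) (X : Fin N → (x : M) → TangentSpace (𝓡 N) x) (u : M) (ξ : REuc N) (v : M) :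
    Prop :=
  ∃ γ : ℝ → M, γ 0 = u ∧ γ 1 = v ∧ (∀ t ∈ Icc (0 : ℝ) 1, γ t ∈ V) ∧
    IsMIntegralCurveOn γ (fun x => ∑ i, ξ i • X i x) (Icc 0 1)

/-- `Φ` is the map `θ_u : ξ ↦ exp (∑ ξ_i X_i) (u)` on the Euclidean ball of radius `r > 0` around
`0`, and it is a `C¹`-diffeomorphism of that ball onto an open subset of `M`. -/
structure IsNormalChart (V : Set M) (X : Fin N → (x : M) → TangentSpace (𝓡 N) x) (u : M) (r : ℝ)
    (Φ : PartialDiffeomorph 𝓘(ℝ, REuc N) (𝓡 N) (REuc N) M 1) : Prop where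
  pos : 0 < r
  source_eq : Φ.source = ball (0 : REuc N) r
  isExp : ∀ ξ ∈ ball (0 : REuc N) r, IsExp V X u ξ (Φ ξ)

/-- `ξ` is the tuple of normal coordinates (coordinates of the first kind) of `v` with respect
to `u`. -/
def IsNormalCoord (V : Set M) (X : Fin N → (x : M) → TangentSpace (𝓡 N) x) (u v : M)
    (ξ : REuc N) : Prop :=
  ∃ r Φ, IsNormalChart V X u r Φ ∧ ξ ∈ ball (0 : REuc N) r ∧ Φ ξ = v

/-- `max_i |ξ_i|^{1 / deg X_i}`. -/
def hNorm (F : FiltrationDims N) (ξ : REuc N) : ℝ≥0∞ :=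
  ⨆ i, ENNReal.ofReal (|ξ i| ^ (1 / (F.deg i : ℝ)))

/-- The quasimetric `d_∞(u, v) = max_i |v_i|^{1 / deg X_i}`, where `(v_i)` are the normal
coordinates of `v` with respect to `u`. These are unique if they exist (the domains of two normal
charts at `u` are concentric balls, so one contains the other); the value is `∞` if `v` has no
normal coordinates with respect to `u`. -/
def dInf (F : FiltrationDims N) (V : Set M) (X : Fin N → (x : M) → TangentSpace (𝓡 N) x)
    (u v : M) : ℝ≥0∞ :=
  ⨅ (ξ : REuc N) (_ : IsNormalCoord V X u v ξ), hNorm F ξ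

/-- `Box(u, ε) = {y ∈ M | d_∞(u, y) < ε}`. -/
def Box (F : FiltrationDims N) (V : Set M) (X : Fin N → (x : M) → TangentSpace (𝓡 N) x)
    (u : M) (ε : ℝ≥0) : Set M :=
  {y | dInf F V X u y < ε}

/-- The diameter of `S` with respect to `d_∞`. -/
def dInfDiam (F : FiltrationDims N) (V : Set M) (X : Fin N → (x : M) → TangentSpace (𝓡 N) x)
    (S : Set M) : ℝ≥0∞ :=
  ⨆ (v ∈ S) (w ∈ S), dInf F V X v w

/-- The sets `U` on which the quasimetric is considered: for each `u ∈ U` some ball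
`B(0, r_u)` is mapped by `θ_u` `C¹`-diffeomorphically onto a set that contains `U`. -/
def NormallyCovered (V : Set M) (X : Fin N → (x : M) → TangentSpace (𝓡 N) x) (U : Set M) : Prop :=
  U ⊆ V ∧ ∀ u ∈ U, ∃ r Φ, IsNormalChart V X u r Φ ∧ U ⊆ Φ '' ball (0 : REuc N) r

end Distance

end

/-! The core is an estimate for two successive exponentials. Write d_k = deg X_k. If |ξ_k|, |η_k| ≤
ε^{d_k}, then exp η (exp ξ u) = exp ζ u with |ζ_k| ≤ (C'ε)^{d_k}. For C¹ fields there is no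
Campbell–Hausdorff formula, so a differential inequality takes its place. Let y(t) run along the
second curve and let ζ(t) be its normal coordinates at u, so that dθ_u(ζ) ζ' = ∑ η_l X_l(y). Expand
dθ_u(ζ) e_k = ∑ B_kl X_l. In the frame, the variational equation of the flow becomes a linear ODE in
which derivatives of the fields occur only through brackets; its matrix is -∑_i ζ_i c_{ijl}. Since
c_{ijl} = 0 when d_l > d_i + d_j, the bounds |ζ_i| ≤ κ ρ^{d_i} make this matrix small with respect
to the weights ρ^{d_l}, and Grönwall shows that B is close to the identity in that sense
(`weighted_gronwall`, `exists_weighted_coords`). Inverting B (`weighted_inverse_bound`) bounds ζ',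
and a barrier argument keeps ζ in the region where the bounds hold (`exists_quasi_triangle`).

The required C¹ dependence of the flow on point and parameter comes from the inverse function
theorem in a space of paths (`exists_contDiffAt_flow`). A second use of that theorem, for (u, ξ) ↦
(u, exp ξ u), gives normal coordinates on a neighborhood with a common radius (`exists_localExp`),
hence normally covered neighborhoods.

Compactness makes the local constants uniform. Two points v = exp ξ u and w = exp η u of a box
satisfy w = exp η (exp (-ξ) v), which gives the diameter bound. The triangle inequality is the core
estimate when the right-hand side is small; otherwise it suffices that d_∞ is bounded on U × U
(`exists_dInf_le_of_normallyCovered`). For that bound, integral curves of any length must depend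
continuously on their data, which is done by continuation along the curve (`hasFlowGerm_one`). -/

/-! ### Paths as a Banach space, and C¹ dependence of flows on initial point and parameter. -/

section PathSpace

variable {E F P : Type*} [NormedAddCommGroup E] [NormedSpace ℝ E]
  [NormedAddCommGroup F] [NormedSpace ℝ F] [NormedAddCommGroup P] [NormedSpace ℝ P]

/-- Paths parametrized by `[0, 1]`, with the supremum norm. -/
abbrev UnitPath (E : Type*) [TopologicalSpace E] : Type _ := C(Icc (0 : ℝ) 1, E)

namespace UnitPath

/-- Constant paths, as a continuous linear map. -/
noncomputable def constL (E : Type*) [NormedAddCommGroup E] [NormedSpace ℝ E] : E →L[ℝ] UnitPath E :=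
  LinearMap.mkContinuous
    { toFun := fun x => ContinuousMap.const _ x
      map_add' := fun _ _ => rfl
      map_smul' := fun _ _ => rfl } 1 fun x => by
    rw [one_mul]
    exact (ContinuousMap.norm_le _ (norm_nonneg x)).2 fun _ => le_rfl

@[simp] lemma constL_apply (x : E) (t : Icc (0 : ℝ) 1) : constL E x t = x := rfl

/-- Pointwise application of a path of operators to a path of vectors. -/
noncomputable def applyL (E F : Type*) [NormedAddCommGroup E] [NormedSpace ℝ E]
    [NormedAddCommGroup F] [NormedSpace ℝ F] :
    UnitPath (E →L[ℝ] F) →L[ℝ] UnitPath E →L[ℝ] UnitPath F :=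
  LinearMap.mkContinuous₂
    (LinearMap.mk₂ ℝ
      (fun (a : UnitPath (E →L[ℝ] F)) (h : UnitPath E) =>
        (⟨fun t => a t (h t), by fun_prop⟩ : UnitPath F))
      (fun _ _ _ => rfl) (fun _ _ _ => rfl)
      (fun a _ _ => ContinuousMap.ext fun t => map_add (a t) _ _)
      (fun _ a _ => ContinuousMap.ext fun t => map_smul (a t) _ _)) 1 fun a h => by
    refine (ContinuousMap.norm_le _ (by positivity)).2 fun t => ?_
    rw [one_mul]
    exact ((a t).le_opNorm _).trans
      (mul_le_mul (a.norm_coe_le_norm t) (h.norm_coe_le_norm t) (norm_nonneg _) (norm_nonneg a))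

/-- The path in a product with given components. -/
noncomputable def prodL (E F : Type*) [NormedAddCommGroup E] [NormedSpace ℝ E]
    [NormedAddCommGroup F] [NormedSpace ℝ F] : (UnitPath E × UnitPath F) →L[ℝ] UnitPath (E × F) :=
  LinearMap.mkContinuous
    { toFun := fun q => q.1.prodMk q.2
      map_add' := fun _ _ => rfl
      map_smul' := fun _ _ => rfl } 1 fun q => by
    rw [one_mul]
    refine (ContinuousMap.norm_le _ (norm_nonneg q)).2 fun t => ?_
    exact max_le_max (q.1.norm_coe_le_norm t) (q.2.norm_coe_le_norm t)

/-- The primitive of a path that vanishes at `0`. -/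
noncomputable def primitive (E : Type*) [NormedAddCommGroup E] [NormedSpace ℝ E] :
    UnitPath E →L[ℝ] UnitPath E :=
  LinearMap.mkContinuous
    { toFun := fun h => ⟨fun t => ∫ s in (0 : ℝ)..t, h (projIcc 0 1 zero_le_one s), by
        have hc : Continuous fun s : ℝ => h (projIcc 0 1 zero_le_one s) :=
          h.continuous.comp continuous_projIcc
        exact (intervalIntegral.continuous_primitive (fun a b => hc.intervalIntegrable a b) 0).comp
          continuous_subtype_val⟩
      map_add' := fun f g => ContinuousMap.ext fun t => by
        have hc (h : UnitPath E) : Continuous fun s : ℝ => h (projIcc 0 1 zero_le_one s) :=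
          h.continuous.comp continuous_projIcc
        exact intervalIntegral.integral_add ((hc f).intervalIntegrable _ _)
          ((hc g).intervalIntegrable _ _)
      map_smul' := fun c f => ContinuousMap.ext fun t => by
        simp [intervalIntegral.integral_smul] } 1 fun h => by
    rw [one_mul]
    refine (ContinuousMap.norm_le _ (norm_nonneg _)).2 fun t => ?_
    refine (intervalIntegral.norm_integral_le_of_norm_le_const
      (fun s _ => h.norm_coe_le_norm (projIcc 0 1 zero_le_one s))).trans ?_
    rw [sub_zero, abs_of_nonneg t.2.1]
    exact mul_le_of_le_one_right (norm_nonneg _) t.2.2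

lemma primitive_apply (h : UnitPath E) (t : Icc (0 : ℝ) 1) :
    primitive E h t = ∫ s in (0 : ℝ)..t, h (projIcc 0 1 zero_le_one s) := rfl

/-- The extension of a path by its end values. -/
noncomputable def extend {X : Type*} [TopologicalSpace X] (h : UnitPath X) (t : ℝ) : X := h (projIcc 0 1 zero_le_one t)

lemma extend_of_mem {X : Type*} [TopologicalSpace X] (h : UnitPath X) {t : ℝ}
    (ht : t ∈ Icc (0 : ℝ) 1) : h.extend t = h ⟨t, ht⟩ := by
  rw [extend, projIcc_of_mem _ ht]

lemma continuous_extend {X : Type*} [TopologicalSpace X] (h : UnitPath X) :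
    Continuous h.extend :=
  h.continuous.comp continuous_projIcc

lemma hasDerivWithinAt_extend [CompleteSpace E] {γ h : UnitPath E} {x : E}
    (H : γ = constL E x + primitive E h) {t : ℝ} (ht : t ∈ Icc (0 : ℝ) 1) :
    HasDerivWithinAt γ.extend (h.extend t) (Icc 0 1) t := by
  have hc := h.continuous_extend
  have h1 : HasDerivAt (fun t : ℝ => x + ∫ s in (0 : ℝ)..t, h.extend s) (h.extend t) t :=
    (intervalIntegral.integral_hasDerivAt_right (hc.intervalIntegrable _ _)
      hc.stronglyMeasurable.stronglyMeasurableAtFilter hc.continuousAt).const_add x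
  refine h1.hasDerivWithinAt.congr (fun s hs => ?_) ?_
  · rw [γ.extend_of_mem hs, H]; rfl
  · rw [γ.extend_of_mem ht, H]; rfl

lemma extend_zero {γ h : UnitPath E} {x : E} (H : γ = constL E x + primitive E h) :
    γ.extend 0 = x := by
  rw [γ.extend_of_mem ⟨le_rfl, zero_le_one⟩, H]
  simp [primitive_apply]

/-- Superposition with a `C¹` map is differentiable on the space of paths. -/
lemma hasFDerivAt_comp {f : E → F} (hf : ContDiff ℝ 1 f) (γ : UnitPath E) :
    HasFDerivAt (fun γ : UnitPath E => (⟨f, hf.continuous⟩ : C(E, F)).comp γ)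
      (applyL E F
        ((⟨fderiv ℝ f, hf.continuous_fderiv one_ne_zero⟩ : C(E, E →L[ℝ] F)).comp γ)) γ := by
  rw [hasFDerivAt_iff_isLittleO_nhds_zero, Asymptotics.isLittleO_iff]
  intro c hc
  -- Uniform continuity of `fderiv ℝ f` near the compact range gives one `δ` for all times, so the
  -- mean value estimate is uniform in `t`.
  have hK : IsCompact (range γ) := isCompact_range γ.continuous
  have hu := hK.uniformContinuousAt_of_continuousAt (fderiv ℝ f)
    (fun a _ => (hf.continuous_fderiv one_ne_zero).continuousAt) (dist_mem_uniformity hc)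
  obtain ⟨δ, hδ, hu⟩ := Metric.mem_uniformity_dist.1 hu
  filter_upwards [ball_mem_nhds (0 : UnitPath E) hδ] with h hh
  rw [mem_ball_zero_iff] at hh
  refine (ContinuousMap.norm_le _ (by positivity)).2 fun t => ?_
  have key := (convex_ball (γ t) δ).norm_image_sub_le_of_norm_hasFDerivWithin_le'
    (f := f) (f' := fderiv ℝ f) (φ := fderiv ℝ f (γ t)) (C := c) (x := γ t) (y := γ t + h t)
    (fun x _ => ((hf.differentiable one_ne_zero) x).hasFDerivAt.hasFDerivWithinAt)
    (fun x hx => by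
      rw [← dist_eq_norm, dist_comm]
      exact (hu (a := γ t) (b := x) (by rwa [dist_comm]) ⟨t, rfl⟩).le)
    (mem_ball_self hδ) (by
      simpa [mem_ball, dist_eq_norm] using (h.norm_coe_le_norm t).trans_lt hh)
  rw [add_sub_cancel_left] at key
  exact key.trans (by gcongr; exact h.norm_coe_le_norm t)

lemma contDiff_comp {f : E → F} (hf : ContDiff ℝ 1 f) :
    ContDiff ℝ 1 (fun γ : UnitPath E => (⟨f, hf.continuous⟩ : C(E, F)).comp γ) := by
  rw [contDiff_one_iff_hasFDerivAt]
  refine ⟨_, ?_, hasFDerivAt_comp hf⟩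
  exact (applyL E F).continuous.comp (ContinuousMap.continuous_postcomp _)

end UnitPath

/-- The path `t ↦ f (ξ, γ t)`. -/
noncomputable def UnitPath.fieldAlong {f : P × E → F} (hf : Continuous f) (ξ : P) (γ : UnitPath E) :
    UnitPath F :=
  (⟨f, hf⟩ : C(P × E, F)).comp (UnitPath.prodL P E (UnitPath.constL P ξ, γ))

/-- A local flow of a family of fields `y ↦ f (ξ, y)` with `f (0, y) = 0`: for `(x, ξ)` close to
`(p, 0)`, the path `Γ (x, ξ)` starts at `x` and is an integral curve of `y ↦ f (ξ, y)`;
it depends `C¹` on `(x, ξ)`. -/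
theorem exists_contDiffAt_flow [CompleteSpace E] [CompleteSpace P] {f : P × E → E}
    (hf : ContDiff ℝ 1 f) (hf₀ : ∀ y, f (0, y) = 0) (p : E) :
    ∃ Γ : E × P → UnitPath E, ContDiffAt ℝ 1 Γ (p, 0) ∧ Γ (p, 0) = UnitPath.constL E p ∧
      ∀ᶠ z in 𝓝 ((p, 0) : E × P), Γ z = UnitPath.constL E z.1 +
        UnitPath.primitive E (UnitPath.fieldAlong hf.continuous z.2 (Γ z)) := by
  let ι : (P × UnitPath E) →L[ℝ] UnitPath (P × E) := (UnitPath.prodL P E).comp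
    (((UnitPath.constL P).comp (ContinuousLinearMap.fst ℝ P (UnitPath E))).prod
      (ContinuousLinearMap.snd ℝ P (UnitPath E)))
  let N : UnitPath (P × E) → UnitPath E := fun γ => (⟨f, hf.continuous⟩ : C(P × E, E)).comp γ
  have hN : ContDiff ℝ 1 N := UnitPath.contDiff_comp hf
  let R : P × UnitPath E → UnitPath E := fun q => UnitPath.primitive E (N (ι q))
  have hR : ContDiff ℝ 1 R := (UnitPath.primitive E).contDiff.comp (hN.comp ι.contDiff)
  -- The integral equation for the curve from x with parameter ξ is Ψ (ξ, γ) = (ξ, const x), to be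
  -- solved by the inverse function theorem.
  let Ψ : P × UnitPath E → P × UnitPath E := fun q => (q.1, q.2 - R q)
  have hΨ : ContDiff ℝ 1 Ψ := contDiff_fst.prodMk (contDiff_snd.sub hR)
  set γ₀ := UnitPath.constL E p
  let B : P →L[ℝ] UnitPath E := (UnitPath.primitive E).comp ((UnitPath.constL E).comp
    ((fderiv ℝ f (0, p)).comp (ContinuousLinearMap.inl ℝ P E)))
  -- As f (0, ·) vanishes, the linearization of `R` at the constant path ignores the path variable.
  -- The derivative of `Ψ` is thus triangular with identity diagonal and has the explicit inverse in
  -- `S`.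
  have hfp : ∀ h : E, fderiv ℝ f (0, p) (0, h) = 0 := fun h => by
    have h1 : HasFDerivAt (fun y : E => f (0, y))
        ((fderiv ℝ f (0, p)).comp (ContinuousLinearMap.inr ℝ P E)) p :=
      HasFDerivAt.comp p ((hf.differentiable one_ne_zero) (0, p)).hasFDerivAt
        (hasFDerivAt_prodMk_right 0 p)
    simp only [hf₀] at h1
    exact congrArg (fun T : E →L[ℝ] E => T h) (h1.unique (hasFDerivAt_const 0 p))
  have hR' : HasFDerivAt R (B.comp (ContinuousLinearMap.fst ℝ P (UnitPath E))) (0, γ₀) := by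
    have h1 := (UnitPath.primitive E).hasFDerivAt.comp (0, γ₀)
      ((UnitPath.hasFDerivAt_comp hf (ι (0, γ₀))).comp (0, γ₀) ι.hasFDerivAt)
    refine h1.congr_fderiv (ContinuousLinearMap.ext fun q => ?_)
    refine congrArg (UnitPath.primitive E) (ContinuousMap.ext fun t => ?_)
    change fderiv ℝ f (0, p) (q.1, q.2 t) = fderiv ℝ f (0, p) (q.1, 0)
    have : ((q.1, q.2 t) : P × E) = (q.1, 0) + (0, q.2 t) := by simp
    rw [this, map_add, hfp, add_zero]
  let S : (P × UnitPath E) ≃L[ℝ] (P × UnitPath E) :=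
    ContinuousLinearEquiv.equivOfInverse
      ((ContinuousLinearMap.fst ℝ P (UnitPath E)).prod
        (ContinuousLinearMap.snd ℝ P (UnitPath E) - B.comp (ContinuousLinearMap.fst ℝ P _)))
      ((ContinuousLinearMap.fst ℝ P (UnitPath E)).prod
        (ContinuousLinearMap.snd ℝ P (UnitPath E) + B.comp (ContinuousLinearMap.fst ℝ P _)))
      (fun q => by simp) (fun q => by simp)
  have hΨ' : HasFDerivAt Ψ (S : (P × UnitPath E) →L[ℝ] (P × UnitPath E)) (0, γ₀) :=
    hasFDerivAt_fst.prodMk (hasFDerivAt_snd.sub hR')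
  have hN₀ : N (ι (0, γ₀)) = 0 := ContinuousMap.ext fun t => hf₀ p
  have hΨ₀ : Ψ (0, γ₀) = (0, γ₀) := by simp [Ψ, R, hN₀]
  have hΨa : ContDiffAt ℝ 1 Ψ (0, γ₀) := hΨ.contDiffAt
  let H := hΨa.localInverse hΨ' one_ne_zero
  have hG : ContDiffAt ℝ 1 H (0, γ₀) := by
    have := hΨa.to_localInverse hΨ' one_ne_zero
    rwa [hΨ₀] at this
  have hG₀ : H (0, γ₀) = (0, γ₀) := by
    have := hΨa.localInverse_apply_image hΨ' one_ne_zero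
    rwa [hΨ₀] at this
  have hGr : ∀ᶠ q in 𝓝 ((0, γ₀) : P × UnitPath E), Ψ (H q) = q := by
    have := (hΨa.hasStrictFDerivAt' hΨ' one_ne_zero).eventually_right_inverse
    rwa [hΨ₀] at this
  let κ : E × P → P × UnitPath E := fun z => (z.2, UnitPath.constL E z.1)
  have hκ : ContDiff ℝ 1 κ := contDiff_snd.prodMk ((UnitPath.constL E).contDiff.comp contDiff_fst)
  refine ⟨fun z => (H (κ z)).2, ?_, ?_, ?_⟩
  · exact contDiffAt_snd.comp (p, 0) (ContDiffAt.comp (p, 0) (g := H) (f := κ) hG hκ.contDiffAt)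
  · exact congrArg Prod.snd hG₀
  · have hc : Filter.Tendsto κ (𝓝 (p, 0)) (𝓝 (0, γ₀)) := hκ.continuous.continuousAt
    filter_upwards [hc.eventually hGr] with z hz
    have h1 : (H (κ z)).1 = z.2 := congrArg Prod.fst hz
    have h2 : (H (κ z)).2 - R (H (κ z)) = UnitPath.constL E z.1 := congrArg Prod.snd hz
    rw [sub_eq_iff_eq_add] at h2
    have h3 : R (H (κ z)) = UnitPath.primitive E
        (UnitPath.fieldAlong hf.continuous z.2 (H (κ z)).2) := by
      change UnitPath.primitive E (N (ι ((H (κ z)).1, (H (κ z)).2))) = _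
      rw [h1]
      rfl
    rw [h3] at h2
    exact h2

/-- The variational equation of a flow. -/
theorem fderiv_flow_eq {f : P × E → E} (hf : ContDiff ℝ 1 f) {Γ : E × P → UnitPath E} {z : E × P}
    (hΓ : DifferentiableAt ℝ Γ z) (h : ∀ᶠ z in 𝓝 z, Γ z = UnitPath.constL E z.1 +
        UnitPath.primitive E (UnitPath.fieldAlong hf.continuous z.2 (Γ z))) (δ : E × P) :
    ∃ g : UnitPath E, fderiv ℝ Γ z δ = UnitPath.constL E δ.1 + UnitPath.primitive E g ∧
      ∀ t, g t = fderiv ℝ f (z.2, Γ z t) (δ.2, fderiv ℝ Γ z δ t) := by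
  let ι : (E × P) →L[ℝ] UnitPath P := (UnitPath.constL P).comp (ContinuousLinearMap.snd ℝ E P)
  have h1 : HasFDerivAt (fun z => UnitPath.prodL P E (ι z, Γ z))
      ((UnitPath.prodL P E).comp (ι.prod (fderiv ℝ Γ z))) z :=
    (UnitPath.prodL P E).hasFDerivAt.comp z (ι.hasFDerivAt.prodMk hΓ.hasFDerivAt)
  have h2 := (UnitPath.primitive E).hasFDerivAt.comp z
      ((UnitPath.hasFDerivAt_comp hf (UnitPath.prodL P E (ι z, Γ z))).comp z h1)
  have h3 := ((UnitPath.constL E).comp (ContinuousLinearMap.fst ℝ E P)).hasFDerivAt (x := z)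
  -- The integral equation holds for all nearby data, so it may be differentiated on both sides.
  have h4 := (h3.add h2).congr_of_eventuallyEq h
  exact ⟨_, congrArg (fun T : E × P →L[ℝ] UnitPath E => T δ) h4.fderiv, fun t => rfl⟩

end PathSpace

/-! ### Linear estimates with the weights ρ ^ d. -/

section WeightedEstimates

variable {N : ℕ} (d : Fin N → ℕ) {ρ : ℝ}

/-- A Grönwall estimate for `b' = e_k + a b`, `b 0 = 0`, in a norm with weights `ρ ^ d l`. -/
theorem weighted_gronwall (hρ : 0 < ρ) (k : Fin N) {b b' : ℝ → Fin N → ℝ}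
    {a : ℝ → Fin N → Fin N → ℝ} {δ : ℝ} (hδ : 0 ≤ δ) (hNδ : N * δ ≤ 1) (hb₀ : b 0 = 0)
    (hb : ∀ t ∈ Icc (0 : ℝ) 1, HasDerivWithinAt b (b' t) (Icc 0 1) t)
    (ode : ∀ t ∈ Icc (0 : ℝ) 1, ∀ l, b' t l = (if l = k then 1 else 0) + ∑ j, a t l j * b t j)
    (ha : ∀ t ∈ Icc (0 : ℝ) 1, ∀ l j, |a t l j| * ρ ^ d j ≤ δ * ρ ^ d l) (l : Fin N) :
    |b 1 l - (if l = k then 1 else 0)| * ρ ^ d k ≤ 2 * (N * δ) * ρ ^ d l := by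
  have hpos (m : ℕ) : 0 < ρ ^ m := pow_pos hρ m
  -- The deviation from the unperturbed solution t e_k, rescaled so that the weighted bounds become
  -- bounds in the sup norm: ‖g'‖ ≤ Nδ (‖g‖ + 1) and g(0) = 0.
  let g : ℝ → Fin N → ℝ := fun t l => (b t l - t * (if l = k then 1 else 0)) * ρ ^ d k / ρ ^ d l
  let g' : ℝ → Fin N → ℝ := fun t l => (b' t l - (if l = k then 1 else 0)) * ρ ^ d k / ρ ^ d l
  have hg : ∀ t ∈ Icc (0 : ℝ) 1, HasDerivWithinAt g (g' t) (Icc 0 1) t := fun t ht => by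
    refine hasDerivWithinAt_pi.2 fun l => ?_
    have h1 := hasDerivWithinAt_pi.1 (hb t ht) l
    have h2 := (hasDerivWithinAt_id t (Icc (0 : ℝ) 1)).mul_const (if l = k then (1 : ℝ) else 0)
    rw [one_mul] at h2
    exact ((h1.sub h2).mul_const _).div_const _
  have hbg : ∀ t j, b t j * ρ ^ d k = ρ ^ d j * (g t j + t * (if j = k then 1 else 0)) := by
    intro t j
    have := (hpos (d j)).ne'
    by_cases hj : j = k
    · subst hj; simp only [g, if_true]; field_simp; ring
    · simp only [g, hj, if_false]; field_simp; ring
  have bound : ∀ t ∈ Ico (0 : ℝ) 1, ‖g' t‖ ≤ N * δ * ‖g t‖ + N * δ := by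
    intro t ht
    have ht' : t ∈ Icc (0 : ℝ) 1 := Ico_subset_Icc_self ht
    refine (pi_norm_le_iff_of_nonneg (by positivity)).2 fun l => ?_
    have e : g' t l = ∑ j, (a t l j * ρ ^ d j / ρ ^ d l) *
        (g t j + t * (if j = k then 1 else 0)) := by
      simp only [g', ode t ht' l, add_sub_cancel_left, Finset.sum_mul, Finset.sum_div]
      refine Finset.sum_congr rfl fun j _ => ?_
      rw [mul_assoc, hbg]
      ring
    rw [e, Real.norm_eq_abs]
    calc |∑ j, (a t l j * ρ ^ d j / ρ ^ d l) * (g t j + t * (if j = k then 1 else 0))|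
        ≤ ∑ j : Fin N, δ * (‖g t‖ + 1) := by
          refine (Finset.abs_sum_le_sum_abs _ _).trans (Finset.sum_le_sum fun j _ => ?_)
          rw [abs_mul, abs_div, abs_mul, abs_of_pos (hpos (d j)), abs_of_pos (hpos (d l))]
          refine mul_le_mul ((div_le_iff₀ (hpos _)).2 (ha t ht' l j)) ?_ (abs_nonneg _) hδ
          refine (abs_add_le _ _).trans (add_le_add (norm_le_pi_norm (g t) j) ?_)
          split_ifs
          · rw [mul_one, abs_of_nonneg ht.1]; exact ht.2.le
          · simp
      _ = N * δ * ‖g t‖ + N * δ := by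
          rw [Finset.sum_const, Finset.card_univ, Fintype.card_fin, nsmul_eq_mul]; ring
  have hgr := norm_le_gronwallBound_of_norm_deriv_right_le (f := g) (f' := g') (δ := 0)
    (K := N * δ) (ε := N * δ) (a := 0) (b := 1) (fun t ht => (hg t ht).continuousWithinAt)
    (fun t ht => (hg t (Ico_subset_Icc_self ht)).mono_of_mem_nhdsWithin
      (Icc_mem_nhdsGE_of_mem ht)) (by
      rw [norm_le_zero_iff]; funext l; simp [g, hb₀]) bound 1 ⟨zero_le_one, le_rfl⟩
  -- The Grönwall bound is e^x - 1 with x = Nδ ≤ 1, and e^x - 1 ≤ 2x there.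
  have hfin : gronwallBound 0 (N * δ) (N * δ) (1 - 0) ≤ 2 * (N * δ) := by
    have hN : 0 ≤ N * δ := by positivity
    rcases hN.eq_or_lt with h0 | h0
    · rw [← h0, gronwallBound_K0]; simp
    · rw [gronwallBound_of_K_ne_0 h0.ne']
      have := Real.abs_exp_sub_one_le (x := N * δ) (by rwa [abs_of_pos h0])
      rw [abs_of_pos h0] at this
      beta_reduce
      rw [zero_mul, zero_add, div_self h0.ne', one_mul, sub_zero, mul_one]
      exact (le_abs_self _).trans this
  have hl := (norm_le_pi_norm (g 1) l).trans (hgr.trans hfin)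
  simp only [g, one_mul, Real.norm_eq_abs, abs_div, abs_mul, abs_of_pos (hpos _)] at hl
  exact (div_le_iff₀ (hpos _)).1 hl

/-- Weighted bounds for the solution of a linear system that is close to the identity. -/
theorem weighted_inverse_bound (hρ : 0 < ρ) {B : Fin N → Fin N → ℝ} {x η : Fin N → ℝ} {e μ : ℝ}
    (hNe : N * e ≤ 1 / 2) (hμ : 0 ≤ μ)
    (hB : ∀ k l, |B k l - (if l = k then 1 else 0)| * ρ ^ d k ≤ e * ρ ^ d l)
    (hx : ∀ l, ∑ k, x k * B k l = η l) (hη : ∀ l, |η l| ≤ μ * ρ ^ d l) (k : Fin N) :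
    |x k| ≤ 2 * μ * ρ ^ d k := by
  have hpos (m : ℕ) : 0 < ρ ^ m := pow_pos hρ m
  let z : Fin N → ℝ := fun k => x k / ρ ^ d k
  have hxz : ∀ k, x k = z k * ρ ^ d k := fun k => by
    simp only [z]; rw [div_mul_cancel₀ _ (hpos _).ne']
  -- The deviation of `B` from the identity is moved to the right; since N e ≤ 1/2, its contribution
  -- is absorbed.
  have key : ‖z‖ ≤ μ + N * e * ‖z‖ := by
    have he : Nonempty (Fin N) := ⟨k⟩
    refine (pi_norm_le_iff_of_nonempty _).2 fun l => ?_
    have e1 : x l = η l - ∑ k, x k * (B k l - (if l = k then 1 else 0)) := by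
      simp [mul_sub, Finset.sum_sub_distrib, hx]
    have h1 : |x l| ≤ μ * ρ ^ d l + ∑ k : Fin N, ‖z‖ * (e * ρ ^ d l) := by
      rw [e1]
      refine (abs_sub _ _).trans (add_le_add (hη l) ?_)
      refine (Finset.abs_sum_le_sum_abs _ _).trans (Finset.sum_le_sum fun j _ => ?_)
      rw [hxz j, abs_mul, abs_mul, abs_of_pos (hpos _), mul_assoc, mul_comm (ρ ^ d j)]
      exact mul_le_mul (norm_le_pi_norm z j) (hB j l)
        (mul_nonneg (abs_nonneg _) (hpos _).le) (norm_nonneg _)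
    rw [Finset.sum_const, Finset.card_univ, Fintype.card_fin, nsmul_eq_mul] at h1
    simp only [z, Real.norm_eq_abs, abs_div, abs_of_pos (hpos _)]
    rw [div_le_iff₀ (hpos _)]
    refine h1.trans_eq ?_
    ring
  have h2 : ‖z‖ ≤ 2 * μ := by nlinarith [norm_nonneg z]
  rw [hxz, abs_mul, abs_of_pos (hpos _)]
  exact mul_le_mul_of_nonneg_right ((norm_le_pi_norm z k).trans h2) (hpos _).le

end WeightedEstimates

/-! ### The variational equation in a graded frame. -/

section CarnotFrame

variable {N : ℕ}

/-- The field `∑ ξ_i Y_i`, as a function of `(ξ, y)`. -/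
def frameField (Y : Fin N → REuc N → REuc N) (q : REuc N × REuc N) : REuc N :=
  ∑ i, q.1 i • Y i q.2

/-- A frame of globally defined `C¹` fields on `ℝᴺ`, which on the open set `W` is a basis with
graded structure coefficients bounded by `C`. -/
structure IsGradedFrame (d : Fin N → ℕ) (Y : Fin N → REuc N → REuc N) (W : Set (REuc N)) (C : ℝ) :
    Prop where
  isOpen : IsOpen W
  contDiff : ∀ i, ContDiff ℝ 1 (Y i)
  linearIndependent : ∀ y ∈ W, LinearIndependent ℝ (fun i => Y i y)
  bracket : ∀ i j, ∀ y ∈ W, ∃ c : Fin N → ℝ, VectorField.lieBracket ℝ (Y i) (Y j) y = ∑ k, c k • Y k y ∧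
    (∀ k, |c k| ≤ C) ∧ ∀ k, d i + d j < d k → c k = 0

lemma contDiff_frameField {Y : Fin N → REuc N → REuc N} (hY : ∀ i, ContDiff ℝ 1 (Y i)) :
    ContDiff ℝ 1 (frameField Y) := by
  unfold frameField
  refine ContDiff.sum fun i _ => ?_
  have h1 : ContDiff ℝ 1 fun q : REuc N × REuc N => q.1 i :=
    (EuclideanSpace.proj (𝕜 := ℝ) i).contDiff.comp contDiff_fst
  have h2 : ContDiff ℝ 1 fun q : REuc N × REuc N => Y i q.2 := (hY i).comp contDiff_snd
  exact h1.smul h2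

lemma frameField_zero (Y : Fin N → REuc N → REuc N) (y : REuc N) : frameField Y (0, y) = 0 := by
  simp [frameField]

lemma fderiv_frameField {Y : Fin N → REuc N → REuc N} (hY : ∀ i, ContDiff ℝ 1 (Y i))
    (q δ : REuc N × REuc N) :
    fderiv ℝ (frameField Y) q δ
      = ∑ i, (δ.1 i • Y i q.2 + q.1 i • fderiv ℝ (Y i) q.2 δ.2) := by
  have h : HasFDerivAt (frameField Y) (∑ i, (q.1 i • ((fderiv ℝ (Y i) q.2).comp
      (ContinuousLinearMap.snd ℝ (REuc N) (REuc N))) +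
      ((EuclideanSpace.proj (𝕜 := ℝ) i).comp
        (ContinuousLinearMap.fst ℝ (REuc N) (REuc N))).smulRight (Y i q.2))) q := by
    unfold frameField
    refine HasFDerivAt.fun_sum fun i _ => ?_
    have h1 : HasFDerivAt (fun q : REuc N × REuc N => q.1 i) ((EuclideanSpace.proj (𝕜 := ℝ) i).comp
        (ContinuousLinearMap.fst ℝ (REuc N) (REuc N))) q :=
      ((EuclideanSpace.proj (𝕜 := ℝ) i).comp
        (ContinuousLinearMap.fst ℝ (REuc N) (REuc N))).hasFDerivAt
    have h2 : HasFDerivAt (fun q : REuc N × REuc N => Y i q.2) ((fderiv ℝ (Y i) q.2).comp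
      (ContinuousLinearMap.snd ℝ (REuc N) (REuc N))) q :=
      HasFDerivAt.comp q (((hY i).differentiable one_ne_zero) q.2).hasFDerivAt hasFDerivAt_snd
    exact h1.smul h2
  rw [h.fderiv, sum_apply]
  refine Finset.sum_congr rfl fun i _ => ?_
  simp [add_comm]

namespace IsGradedFrame

variable {d : Fin N → ℕ} {Y : Fin N → REuc N → REuc N} {W : Set (REuc N)} {C : ℝ}

/-- The coordinates of a differentiable field along a differentiable curve in a frame are
differentiable. -/
lemma exists_coords (h : IsGradedFrame d Y W C) {γ w γ' w' : ℝ → REuc N}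
    (hγ : ∀ t ∈ Icc (0 : ℝ) 1, HasDerivWithinAt γ (γ' t) (Icc 0 1) t)
    (hw : ∀ t ∈ Icc (0 : ℝ) 1, HasDerivWithinAt w (w' t) (Icc 0 1) t)
    (hγW : ∀ t ∈ Icc (0 : ℝ) 1, γ t ∈ W) :
    ∃ b b' : ℝ → Fin N → ℝ, (∀ t ∈ Icc (0 : ℝ) 1, HasDerivWithinAt b (b' t) (Icc 0 1) t) ∧
      (∀ t ∈ Icc (0 : ℝ) 1, w t = ∑ l, b t l • Y l (γ t)) ∧
      ∀ t ∈ Icc (0 : ℝ) 1, w' t =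
        ∑ l, (b' t l • Y l (γ t) + b t l • fderiv ℝ (Y l) (γ t) (γ' t)) := by
  let T : REuc N → (REuc N →L[ℝ] REuc N) := fun y =>
    ∑ i, (EuclideanSpace.proj (𝕜 := ℝ) i : REuc N →L[ℝ] ℝ).smulRight (Y i y)
  have hTa : ∀ y ξ, T y ξ = ∑ i, ξ i • Y i y := fun y ξ => by
    simp [T]
  have hT : ContDiff ℝ 1 T := ContDiff.sum fun i _ => contDiff_const.smulRight (h.contDiff i)
  have hinj : ∀ y ∈ W, Function.Injective (T y) := fun y hy => by
    rw [injective_iff_map_eq_zero]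
    intro ξ hξ
    rw [hTa] at hξ
    ext i
    exact Fintype.linearIndependent_iff.1 (h.linearIndependent y hy) _ hξ i
  -- Inversion of operators is smooth at invertible ones, so the coordinates inherit
  -- differentiability from `γ` and `w`.
  let β : ℝ → REuc N := fun t => (T (γ t)).inverse (w t)
  have hequiv : ∀ t ∈ Icc (0 : ℝ) 1, ∃ e : REuc N ≃L[ℝ] REuc N,
      (e : REuc N →L[ℝ] REuc N) = T (γ t) := fun t ht =>
    ⟨(LinearEquiv.ofInjectiveEndo _ (hinj _ (hγW t ht))).toContinuousLinearEquiv,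
      ContinuousLinearMap.ext fun _ => rfl⟩
  have hTγ : ∀ t ∈ Icc (0 : ℝ) 1,
      HasDerivWithinAt (fun t => T (γ t)) (fderiv ℝ T (γ t) (γ' t)) (Icc 0 1) t := fun t ht =>
    ((hT.differentiable one_ne_zero) (γ t)).hasFDerivAt.comp_hasDerivWithinAt t (hγ t ht)
  have hβ : ∀ t ∈ Icc (0 : ℝ) 1, DifferentiableWithinAt ℝ β (Icc 0 1) t := fun t ht => by
    obtain ⟨e, he⟩ := hequiv t ht
    have h1 : DifferentiableAt ℝ ContinuousLinearMap.inverse (T (γ t)) := by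
      rw [← he]
      exact (contDiffAt_map_inverse (n := 1) e).differentiableAt one_ne_zero
    exact (h1.comp_differentiableWithinAt t (hTγ t ht).differentiableWithinAt).clm_apply
      (hw t ht).differentiableWithinAt
  have hβw : ∀ t ∈ Icc (0 : ℝ) 1, T (γ t) (β t) = w t := fun t ht => by
    obtain ⟨e, he⟩ := hequiv t ht
    simp [β, ← he]
  refine ⟨fun t l => β t l, fun t l => derivWithin β (Icc 0 1) t l, fun t ht => ?_, fun t ht => ?_,
    fun t ht => ?_⟩
  · refine hasDerivWithinAt_pi.2 fun l => ?_
    exact (EuclideanSpace.proj (𝕜 := ℝ) l).hasFDerivAt.comp_hasDerivWithinAt t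
      (hβ t ht).hasDerivWithinAt
  · rw [← hβw t ht, hTa]
  · have h1 := (hTγ t ht).clm_apply (hβ t ht).hasDerivWithinAt
    have h2 := (h1.congr (f₁ := w) (fun s hs => (hβw s hs).symm) (hβw t ht).symm)
    have h3 := (uniqueDiffOn_Icc zero_lt_one t ht).eq_deriv _ (hw t ht) h2
    have h4 : fderiv ℝ T (γ t) (γ' t)
        = ∑ i, (EuclideanSpace.proj (𝕜 := ℝ) i : REuc N →L[ℝ] ℝ).smulRight
          (fderiv ℝ (Y i) (γ t) (γ' t)) := by
      have : HasFDerivAt T (∑ i, ((ContinuousLinearMap.smulRightL ℝ (REuc N) (REuc N)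
          (EuclideanSpace.proj (𝕜 := ℝ) i)).comp (fderiv ℝ (Y i) (γ t)))) (γ t) :=
        HasFDerivAt.fun_sum fun i _ =>
          (ContinuousLinearMap.smulRightL ℝ (REuc N) (REuc N)
            (EuclideanSpace.proj (𝕜 := ℝ) i)).hasFDerivAt.comp (γ t)
            (((h.contDiff i).differentiable one_ne_zero) (γ t)).hasFDerivAt
      rw [this.fderiv, sum_apply]
      rfl
    rw [h3, h4, hTa, Finset.sum_add_distrib, add_comm, sum_apply]
    rfl

/-- The derivative of `ξ ↦ exp (∑ ξ_i Y_i)`, expressed in the frame, is close to the identity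
in a weighted norm. -/
theorem exists_weighted_coords (h : IsGradedFrame d Y W C) (hC : 0 ≤ C) {ρ κ : ℝ} (hρ : 0 < ρ)
    (hρ1 : ρ ≤ 1) (hκ : 0 ≤ κ) (hκC : N * (N * (C * κ)) ≤ 1) {ξ : REuc N}
    (hξ : ∀ i, |ξ i| ≤ κ * ρ ^ d i) (k : Fin N) {γ w : ℝ → REuc N}
    (hγ : ∀ t ∈ Icc (0 : ℝ) 1, HasDerivWithinAt γ (frameField Y (ξ, γ t)) (Icc 0 1) t)
    (hw : ∀ t ∈ Icc (0 : ℝ) 1, HasDerivWithinAt w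
      (fderiv ℝ (frameField Y) (ξ, γ t) (EuclideanSpace.single k 1, w t)) (Icc 0 1) t)
    (hw₀ : w 0 = 0) (hγW : ∀ t ∈ Icc (0 : ℝ) 1, γ t ∈ W) :
    ∃ B : Fin N → ℝ, w 1 = ∑ l, B l • Y l (γ 1) ∧
      ∀ l, |B l - (if l = k then 1 else 0)| * ρ ^ d k ≤ 2 * (N * (N * (C * κ))) * ρ ^ d l := by
  obtain ⟨b, b', hb, hbw, hbw'⟩ := h.exists_coords hγ hw hγW
  have h01 : (0 : ℝ) ∈ Icc (0 : ℝ) 1 := ⟨le_rfl, zero_le_one⟩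
  -- The coefficients are chosen separately at each time, with 0 outside [0, 1]; the Grönwall
  -- estimate needs only their bounds, not continuity in `t`.
  have hc : ∀ t : ℝ, ∃ c : Fin N → Fin N → Fin N → ℝ, t ∈ Icc (0 : ℝ) 1 →
      ∀ i j, VectorField.lieBracket ℝ (Y i) (Y j) (γ t) = ∑ k, c i j k • Y k (γ t) ∧
        (∀ k, |c i j k| ≤ C) ∧ ∀ k, d i + d j < d k → c i j k = 0 := fun t => by
    by_cases ht : t ∈ Icc (0 : ℝ) 1
    · choose c hc using fun i j => h.bracket i j (γ t) (hγW t ht)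
      exact ⟨c, fun _ => hc⟩
    · exact ⟨0, fun h => absurd h ht⟩
  choose c hc using hc
  let a : ℝ → Fin N → Fin N → ℝ := fun t l j => - ∑ i, ξ i * c t i j l
  have hb₀ : b 0 = 0 := by
    have h1 := hbw 0 h01
    rw [hw₀] at h1
    funext l
    exact Fintype.linearIndependent_iff.1 (h.linearIndependent _ (hγW 0 h01)) _ h1.symm l
  refine ⟨b 1, hbw 1 ⟨zero_le_one, le_rfl⟩, fun l => ?_⟩
  refine weighted_gronwall d hρ k (by positivity) hκC hb₀ hb (a := a) (fun t ht l => ?_)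
    (fun t ht l j => ?_) l
  -- Differentiating w = ∑ b_l Y_l(γ) and comparing with the variational equation gives ∑ b_l' Y_l =
  -- Y_k - ∑ ξ_i b_j [Y_i, Y_j]: the derivatives of the fields combine into brackets.
  · have h1 : ∑ l, b' t l • Y l (γ t) =
        ∑ l, ((if l = k then 1 else 0) + ∑ j, a t l j * b t j) • Y l (γ t) := by
      have h2 := hbw' t ht
      rw [fderiv_frameField h.contDiff] at h2
      simp only [Finset.sum_add_distrib] at h2
      have e1 : ∑ i, (EuclideanSpace.single k (1 : ℝ) : REuc N) i • Y i (γ t) = Y k (γ t) := by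
        simp [PiLp.single_apply]
      have e2 : ∑ l, ((if l = k then (1 : ℝ) else 0) + ∑ j, a t l j * b t j) • Y l (γ t)
          = Y k (γ t) - ∑ i, ∑ j, (ξ i * b t j) • VectorField.lieBracket ℝ (Y i) (Y j) (γ t) := by
        have e3 : ∀ i j, (ξ i * b t j) • VectorField.lieBracket ℝ (Y i) (Y j) (γ t)
            = ∑ l, (ξ i * b t j * c t i j l) • Y l (γ t) := fun i j => by
          rw [(hc t ht i j).1, Finset.smul_sum]
          simp only [smul_smul]
        simp only [e3]
        simp only [add_smul, Finset.sum_add_distrib, ite_smul, one_smul, zero_smul,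
          Finset.sum_ite_eq', Finset.mem_univ, if_true, sub_eq_add_neg]
        congr 1
        have e4 : ∑ i, ∑ j, ∑ l, (ξ i * b t j * c t i j l) • Y l (γ t)
            = ∑ l, ∑ j, ∑ i, (ξ i * b t j * c t i j l) • Y l (γ t) := by
          rw [Finset.sum_comm]
          simp_rw [Finset.sum_comm (s := Finset.univ (α := Fin N)) (t := Finset.univ (α := Fin N))
            (f := fun i l => (ξ i * b t _ * c t i _ l) • Y l (γ t))]
          rw [Finset.sum_comm]
        rw [e4, ← Finset.sum_neg_distrib]
        refine Finset.sum_congr rfl fun l _ => ?_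
        rw [← Finset.sum_neg_distrib, Finset.sum_smul]
        refine Finset.sum_congr rfl fun j _ => ?_
        simp only [a]
        rw [neg_mul, neg_smul, Finset.sum_mul, Finset.sum_smul]
        congr 1
        refine Finset.sum_congr rfl fun i _ => ?_
        congr 1
        ring
      have e5 : ∑ i, ∑ j, (ξ i * b t j) • VectorField.lieBracket ℝ (Y i) (Y j) (γ t)
          = ∑ l, b t l • fderiv ℝ (Y l) (γ t) (frameField Y (ξ, γ t))
            - ∑ i, ξ i • fderiv ℝ (Y i) (γ t) (w t) := by
        simp only [VectorField.lieBracket, smul_sub, Finset.sum_sub_distrib]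
        congr 1
        · rw [Finset.sum_comm]
          refine Finset.sum_congr rfl fun j _ => ?_
          rw [frameField, map_sum, Finset.smul_sum]
          refine Finset.sum_congr rfl fun i _ => ?_
          rw [map_smul, smul_smul, mul_comm]
        · refine Finset.sum_congr rfl fun i _ => ?_
          rw [hbw t ht, map_sum, Finset.smul_sum]
          refine Finset.sum_congr rfl fun j _ => ?_
          rw [map_smul, smul_smul]
      rw [e2, e5]
      rw [e1] at h2
      rw [eq_sub_of_add_eq h2.symm]
      abel
    have h3 := Fintype.linearIndependent_iff.1 (h.linearIndependent _ (hγW t ht))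
      (fun l => b' t l - ((if l = k then 1 else 0) + ∑ j, a t l j * b t j))
      (by simp only [sub_smul, Finset.sum_sub_distrib]; rw [h1, sub_self]) l
    exact sub_eq_zero.1 h3
  · have hpos (m : ℕ) : 0 < ρ ^ m := pow_pos hρ m
    simp only [a, abs_neg]
    calc |∑ i, ξ i * c t i j l| * ρ ^ d j ≤ (∑ i, |ξ i * c t i j l|) * ρ ^ d j :=
          mul_le_mul_of_nonneg_right (Finset.abs_sum_le_sum_abs _ _) (hpos _).le
      _ = ∑ i, |ξ i * c t i j l| * ρ ^ d j := Finset.sum_mul ..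
      _ ≤ ∑ i : Fin N, C * κ * ρ ^ d l := by
          refine Finset.sum_le_sum fun i _ => ?_
          obtain ⟨-, hcC, hc0⟩ := hc t ht i j
          -- Here the grading enters: either the coefficient vanishes, or d_l ≤ d_i + d_j and ρ ≤ 1
          -- gives ρ^{d_i} ρ^{d_j} ≤ ρ^{d_l}.
          rcases lt_or_ge (d i + d j) (d l) with hlt | hge
          · rw [hc0 l hlt]
            simp only [mul_zero, abs_zero, zero_mul]
            have := (hpos (d l)).le
            positivity
          · calc |ξ i * c t i j l| * ρ ^ d j = |c t i j l| * (|ξ i| * ρ ^ d j) := by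
                  rw [abs_mul]; ring
              _ ≤ C * (κ * ρ ^ d i * ρ ^ d j) := by
                  refine mul_le_mul (hcC l) (mul_le_mul_of_nonneg_right (hξ i) (hpos _).le) ?_ hC
                  exact mul_nonneg (abs_nonneg _) (hpos _).le
              _ = C * κ * ρ ^ (d i + d j) := by rw [pow_add]; ring
              _ ≤ C * κ * ρ ^ d l :=
                  mul_le_mul_of_nonneg_left (pow_le_pow_of_le_one hρ.le hρ1 hge) (by positivity)
      _ = N * (C * κ) * ρ ^ d l := by
          rw [Finset.sum_const, Finset.card_univ, Fintype.card_fin, nsmul_eq_mul]; ring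

end IsGradedFrame

end CarnotFrame

/-! ### Localization of the frame, and its exponential map near a point. -/

section LocalExponential

variable {N : ℕ}

/-- Near each point, a graded `C¹` frame coincides with a globally defined one, with bounded
structure coefficients. -/
theorem exists_isGradedFrame {d : Fin N → ℕ} {Y : Fin N → REuc N → REuc N} {W : Set (REuc N)}
    (hW : IsOpen W) (hY : ∀ i, ContDiffOn ℝ 1 (Y i) W)
    (hli : ∀ y ∈ W, LinearIndependent ℝ (fun i => Y i y))
    (hbr : ∀ i j, ∀ y ∈ W, ∃ c : Fin N → ℝ,
      VectorField.lieBracket ℝ (Y i) (Y j) y = ∑ k with d k ≤ d i + d j, c k • Y k y)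
    {p : REuc N} (hp : p ∈ W) :
    ∃ (Z : Fin N → REuc N → REuc N) (W' : Set (REuc N)) (C : ℝ), IsGradedFrame d Z W' C ∧ 0 ≤ C ∧
      p ∈ W' ∧ W' ⊆ W ∧ ∀ i, EqOn (Z i) (Y i) W' := by
  obtain ⟨s, hs, hsW⟩ := Metric.isOpen_iff.1 hW p hp
  -- The cutoff is 1 near `p` and supported in `W`, so the products extend by 0 to global C¹ fields.
  let φ : ContDiffBump p := ⟨s / 4, s / 2, by positivity, by linarith⟩
  let Z : Fin N → REuc N → REuc N := fun i y => φ y • Y i y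
  have hZY : ∀ i, EqOn (Z i) (Y i) (ball p (s / 4)) := fun i y hy => by
    simp only [Z]
    rw [φ.one_of_mem_closedBall (ball_subset_closedBall hy), one_smul]
  have hZ : ∀ i, ContDiff ℝ 1 (Z i) := fun i => by
    rw [contDiff_iff_contDiffAt]
    intro y
    by_cases hy : y ∈ W
    · exact φ.contDiff.contDiffAt.smul ((hY i).contDiffAt (hW.mem_nhds hy))
    · have hy' : y ∉ tsupport φ := by
        rw [φ.tsupport_eq]
        intro h
        exact hy (hsW (closedBall_subset_ball (by change s / 2 < s; linarith) h))
      have : Z i =ᶠ[𝓝 y] fun _ => 0 := by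
        filter_upwards [notMem_tsupport_iff_eventuallyEq.1 hy'] with x hx
        simp [Z, hx]
      exact contDiffAt_const.congr_of_eventuallyEq this
  let T : REuc N → (REuc N →L[ℝ] REuc N) := fun y =>
    ∑ i, (EuclideanSpace.proj (𝕜 := ℝ) i : REuc N →L[ℝ] ℝ).smulRight (Z i y)
  have hTa : ∀ y ξ, T y ξ = ∑ i, ξ i • Z i y := fun y ξ => by simp [T]
  have hT : ContDiff ℝ 1 T := ContDiff.sum fun i _ => contDiff_const.smulRight (hZ i)
  have hliZ : ∀ y ∈ ball p (s / 4), LinearIndependent ℝ (fun i => Z i y) := fun y hy => by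
    have : (fun i => Z i y) = fun i => Y i y := funext fun i => hZY i hy
    rw [this]
    exact hli y (hsW (ball_subset_ball (by linarith) hy))
  have hpb : p ∈ ball p (s / 4) := mem_ball_self (by positivity)
  have hinj : Function.Injective (T p) := by
    rw [injective_iff_map_eq_zero]
    intro ξ hξ
    rw [hTa] at hξ
    ext i
    exact Fintype.linearIndependent_iff.1 (hliZ p hpb) _ hξ i
  obtain ⟨K, hK⟩ : ∃ K : ℝ, ∀ ξ, ‖ξ‖ ≤ K * ‖T p ξ‖ := by
    let e : REuc N ≃L[ℝ] REuc N :=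
      (LinearEquiv.ofInjectiveEndo (T p : REuc N →ₗ[ℝ] REuc N) hinj).toContinuousLinearEquiv
    refine ⟨‖(e.symm : REuc N →L[ℝ] REuc N)‖, fun ξ => ?_⟩
    have h1 : e.symm (T p ξ) = ξ := e.symm_apply_apply ξ
    calc ‖ξ‖ = ‖(e.symm : REuc N →L[ℝ] REuc N) (T p ξ)‖ := by rw [ContinuousLinearEquiv.coe_coe, h1]
      _ ≤ _ := ContinuousLinearMap.le_opNorm _ _
  let K' : ℝ := |K| + 1
  have hK' : 0 < K' := by positivity
  have hK1 : ∀ ξ, ‖ξ‖ ≤ K' * ‖T p ξ‖ := fun ξ => (hK ξ).trans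
    (mul_le_mul_of_nonneg_right ((le_abs_self K).trans (by simp [K'])) (norm_nonneg _))
  -- The structure coefficients are not assumed continuous. They are bounded because the brackets
  -- are locally bounded and the frame matrix `T y` stays uniformly invertible near `p`.
  let L : REuc N → ℝ := fun y => ∑ i, ∑ j, ‖VectorField.lieBracket ℝ (Z i) (Z j) y‖
  have hL : Continuous L := by
    refine continuous_finsetSum _ fun i _ => continuous_finsetSum _ fun j _ => continuous_norm.comp ?_
    exact (((hZ j).continuous_fderiv one_ne_zero).clm_apply (hZ i).continuous).sub
      (((hZ i).continuous_fderiv one_ne_zero).clm_apply (hZ j).continuous)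
  have ev1 : ∀ᶠ y in 𝓝 p, ‖T y - T p‖ < 1 / (2 * K') := by
    have := (hT.continuous.continuousAt (x := p)).eventually (ball_mem_nhds (T p)
      (by positivity : 0 < 1 / (2 * K')))
    simpa [mem_ball, dist_eq_norm] using this
  have ev2 : ∀ᶠ y in 𝓝 p, L y < L p + 1 :=
    (hL.continuousAt (x := p)).eventually (gt_mem_nhds (by linarith))
  obtain ⟨W', hW's, hW'o, hpW'⟩ := _root_.eventually_nhds_iff.1
    ((ev1.and ev2).and (ball_mem_nhds p (by positivity : 0 < s / 4)))
  have hsub : W' ⊆ ball p (s / 4) := fun y hy => (hW's y hy).2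
  have hLp : 0 ≤ L p := Finset.sum_nonneg fun i _ => Finset.sum_nonneg fun j _ => norm_nonneg _
  refine ⟨Z, W', 2 * K' * (L p + 1), ⟨hW'o, hZ, fun y hy => hliZ y (hsub hy), ?_⟩, by positivity,
    hpW', fun y hy => hsW (ball_subset_ball (by linarith) (hsub hy)), fun i y hy => hZY i (hsub hy)⟩
  intro i j y hy
  have hyb := hsub hy
  have hbreq : VectorField.lieBracket ℝ (Z i) (Z j) y = VectorField.lieBracket ℝ (Y i) (Y j) y := by
    have hev : ∀ i, Z i =ᶠ[𝓝 y] Y i := fun i =>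
      Filter.eventually_of_mem (isOpen_ball.mem_nhds hyb) fun x hx => hZY i hx
    exact (hev i).lieBracket_vectorField_eq (hev j)
  obtain ⟨c, hc⟩ := hbr i j y (hsW (ball_subset_ball (by linarith) hyb))
  let c' : Fin N → ℝ := fun k => if d k ≤ d i + d j then c k else 0
  have hc' : VectorField.lieBracket ℝ (Z i) (Z j) y = ∑ k, c' k • Z k y := by
    rw [hbreq, hc, Finset.sum_filter]
    refine Finset.sum_congr rfl fun k _ => ?_
    rw [hZY k hyb]
    simp only [c']
    split_ifs <;> simp
  refine ⟨c', hc', fun k => ?_, fun k hk => by simp [c', hk.not_ge]⟩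
  let ξ : REuc N := WithLp.toLp 2 c'
  have h1 : ‖T y ξ‖ ≤ L p + 1 := by
    rw [hTa]
    change ‖∑ i, c' i • Z i y‖ ≤ _
    rw [← hc']
    refine le_trans ?_ (hW's y hy).1.2.le
    calc ‖VectorField.lieBracket ℝ (Z i) (Z j) y‖
        ≤ ∑ j, ‖VectorField.lieBracket ℝ (Z i) (Z j) y‖ :=
          Finset.single_le_sum (f := fun j => ‖VectorField.lieBracket ℝ (Z i) (Z j) y‖)
            (fun _ _ => norm_nonneg _) (Finset.mem_univ j)
      _ ≤ L y := Finset.single_le_sum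
            (f := fun i => ∑ j, ‖VectorField.lieBracket ℝ (Z i) (Z j) y‖)
            (fun _ _ => Finset.sum_nonneg fun _ _ => norm_nonneg _) (Finset.mem_univ i)
  -- Replacing `T p` by `T y` costs at most half of ‖ξ‖, which doubles the constant of
  -- invertibility.
  have h2 : ‖ξ‖ ≤ 2 * K' * ‖T y ξ‖ := by
    have h3 := hK1 ξ
    have h4 : T p ξ = T y ξ - (T y - T p) ξ := by simp
    have h5 : ‖(T y - T p) ξ‖ ≤ 1 / (2 * K') * ‖ξ‖ :=
      (ContinuousLinearMap.le_opNorm _ _).trans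
        (mul_le_mul_of_nonneg_right (hW's y hy).1.1.le (norm_nonneg _))
    have h6 : ‖T p ξ‖ ≤ ‖T y ξ‖ + 1 / (2 * K') * ‖ξ‖ := by
      rw [h4]; exact (norm_sub_le _ _).trans (add_le_add_right h5 _)
    have h7 : K' * (1 / (2 * K') * ‖ξ‖) = ‖ξ‖ / 2 := by field_simp
    nlinarith
  calc |c' k| = ‖ξ k‖ := rfl
    _ ≤ ‖ξ‖ := PiLp.norm_apply_le ξ k
    _ ≤ 2 * K' * (L p + 1) := h2.trans (by gcongr)

/-- The exponential map of a frame near a point `p`: the curves `Γ (u, ξ)` join `u` to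
`exp (∑ ξ_i Y_i) (u)`, and `chart` is `(u, ξ) ↦ (u, exp (∑ ξ_i Y_i) (u))`. -/
structure LocalExp (Y : Fin N → REuc N → REuc N) (W : Set (REuc N)) (p : REuc N) where
  base : Set (REuc N)
  radius : ℝ
  Γ : REuc N × REuc N → UnitPath (REuc N)
  chart : OpenPartialHomeomorph (REuc N × REuc N) (REuc N × REuc N)
  isOpen_base : IsOpen base
  mem_base : p ∈ base
  radius_pos : 0 < radius
  source_eq : chart.source = base ×ˢ ball 0 radius
  contDiffAt_Γ : ∀ z ∈ chart.source, ContDiffAt ℝ 1 Γ z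
  mem : ∀ z ∈ chart.source, ∀ t, Γ z t ∈ W
  Γ_zero : ∀ z ∈ chart.source, (Γ z).extend 0 = z.1
  hasDeriv : ∀ z ∈ chart.source, ∀ t ∈ Icc (0 : ℝ) 1,
    HasDerivWithinAt (Γ z).extend (frameField Y (z.2, (Γ z).extend t)) (Icc 0 1) t
  chart_apply : ∀ z, chart z = (z.1, (Γ z).extend 1)
  contDiffAt_symm : ∀ z ∈ chart.target, ContDiffAt ℝ 1 chart.symm z
  mem_target : (p, p) ∈ chart.target
  Γ_center : Γ (p, 0) = UnitPath.constL _ p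
  hasDeriv_variation : ∀ z ∈ chart.source, ∀ k, ∀ t ∈ Icc (0 : ℝ) 1,
    HasDerivWithinAt (fderiv ℝ Γ z (0, EuclideanSpace.single k 1)).extend
      (fderiv ℝ (frameField Y) (z.2, (Γ z).extend t) (EuclideanSpace.single k 1,
        (fderiv ℝ Γ z (0, EuclideanSpace.single k 1)).extend t)) (Icc 0 1) t
  variation_zero : ∀ z ∈ chart.source, ∀ k,
    (fderiv ℝ Γ z (0, EuclideanSpace.single k 1)).extend 0 = 0

/-- The map (u, ξ) ↦ (u, exp ξ u) has derivative (a, b) ↦ (a, a + ∑ b_i Y_i(p)) at (p, 0), which is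
invertible because the fields form a basis. Keeping `u` as a variable gives all base points near `p`
the same radius, and the target contains every pair of points near `p`. -/
theorem exists_localExp {Y : Fin N → REuc N → REuc N} {W : Set (REuc N)}
    (hW : IsOpen W) (hY : ∀ i, ContDiff ℝ 1 (Y i))
    (hli : ∀ y ∈ W, LinearIndependent ℝ (fun i => Y i y)) {p : REuc N} (hp : p ∈ W) :
    Nonempty (LocalExp Y W p) := by
  have hf := contDiff_frameField hY
  obtain ⟨Γ, hΓ, hΓ₀, hΓe⟩ := exists_contDiffAt_flow hf (frameField_zero Y) p
  let ev : UnitPath (REuc N) →L[ℝ] REuc N :=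
    ContinuousMap.evalCLM ℝ (⟨1, zero_le_one, le_rfl⟩ : Icc (0 : ℝ) 1)
  have hev : ∀ g : UnitPath (REuc N), ev g = g.extend 1 := fun g =>
    (g.extend_of_mem ⟨zero_le_one, le_rfl⟩).symm
  let G : REuc N × REuc N → REuc N × REuc N := fun z => (z.1, ev (Γ z))
  have hG : ContDiffAt ℝ 1 G (p, 0) := contDiffAt_fst.prodMk (ev.contDiff.contDiffAt.comp _ hΓ)
  -- the derivative of `G` at the center
  let T : REuc N →L[ℝ] REuc N :=
    ∑ i, (EuclideanSpace.proj (𝕜 := ℝ) i : REuc N →L[ℝ] ℝ).smulRight (Y i p)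
  have hTa : ∀ ξ, T ξ = ∑ i, ξ i • Y i p := fun ξ => by simp [T]
  have hinj : Function.Injective T := by
    rw [injective_iff_map_eq_zero]
    intro ξ hξ
    rw [hTa] at hξ
    ext i
    exact Fintype.linearIndependent_iff.1 (hli p hp) _ hξ i
  let e : REuc N ≃L[ℝ] REuc N :=
    (LinearEquiv.ofInjectiveEndo (T : REuc N →ₗ[ℝ] REuc N) hinj).toContinuousLinearEquiv
  have he : ∀ ξ, e ξ = T ξ := fun _ => rfl
  let S : (REuc N × REuc N) ≃L[ℝ] (REuc N × REuc N) := ContinuousLinearEquiv.equivOfInverse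
    ((ContinuousLinearMap.fst ℝ (REuc N) (REuc N)).prod
      (ContinuousLinearMap.fst ℝ (REuc N) (REuc N) + T.comp (ContinuousLinearMap.snd ℝ _ _)))
    ((ContinuousLinearMap.fst ℝ (REuc N) (REuc N)).prod
      ((e.symm : REuc N →L[ℝ] REuc N).comp
        (ContinuousLinearMap.snd ℝ (REuc N) (REuc N) - ContinuousLinearMap.fst ℝ _ _)))
    (fun q => by simp [← he]) (fun q => by simp [← he])
  have hG' : HasFDerivAt G (S : REuc N × REuc N →L[ℝ] REuc N × REuc N) (p, 0) := by
    have hd := (hΓ.differentiableAt one_ne_zero)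
    have h1 : HasFDerivAt G ((ContinuousLinearMap.fst ℝ (REuc N) (REuc N)).prod
        (ev.comp (fderiv ℝ Γ (p, 0)))) (p, 0) :=
      hasFDerivAt_fst.prodMk (ev.hasFDerivAt.comp _ hd.hasFDerivAt)
    refine h1.congr_fderiv (ContinuousLinearMap.ext fun δ => ?_)
    obtain ⟨g, hg, hgt⟩ := fderiv_flow_eq hf hd hΓe δ
    refine Prod.ext rfl ?_
    change ev (fderiv ℝ Γ (p, 0) δ) = δ.1 + T δ.2
    -- At ξ = 0 the curve is constant and the field vanishes, so the integrand of the variational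
    -- equation does not depend on time.
    have hgc : g = UnitPath.constL _ (T δ.2) := ContinuousMap.ext fun t => by
      rw [hgt, fderiv_frameField hY, hΓ₀, UnitPath.constL_apply, UnitPath.constL_apply, hTa]
      simp
    rw [hg, hgc, map_add]
    congr 1
    change UnitPath.primitive _ _ _ = _
    rw [UnitPath.primitive_apply]
    simp
  have hG₀ : G (p, 0) = (p, p) := by simp [G, hΓ₀, ev]
  let H := hG.toOpenPartialHomeomorph G hG' one_ne_zero
  have hH : ∀ z, H z = G z := fun _ => rfl
  have hHs : (p, 0) ∈ H.source := hG.mem_toOpenPartialHomeomorph_source hG' one_ne_zero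
  have hHt : (p, p) ∈ H.target := by
    have := hG.image_mem_toOpenPartialHomeomorph_target hG' one_ne_zero
    rwa [hG₀] at this
  have hsymm : ∀ᶠ q in 𝓝 (p, p), ContDiffAt ℝ 1 H.symm q := by
    have := hG.to_localInverse hG' one_ne_zero
    rw [hG₀] at this
    exact this.eventually (by simp)
  have hsymm' : ∀ᶠ z in 𝓝 ((p, 0) : REuc N × REuc N), ContDiffAt ℝ 1 H.symm (H z) := by
    have hc : ContinuousAt H (p, 0) := hG.continuousAt
    have : Filter.Tendsto H (𝓝 (p, 0)) (𝓝 (p, p)) := by rw [← hG₀]; exact hc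
    exact this.eventually hsymm
  have hWe : ∀ᶠ z in 𝓝 ((p, 0) : REuc N × REuc N), ∀ t, Γ z t ∈ W := by
    obtain ⟨s, hs, hsW⟩ := Metric.isOpen_iff.1 hW p hp
    have h1 := hΓ.continuousAt.eventually (ball_mem_nhds _ hs)
    filter_upwards [h1] with z hz t
    refine hsW ?_
    rw [hΓ₀] at hz
    exact (ContinuousMap.dist_apply_le_dist t).trans_lt hz
  have hall := (hΓ.eventually (by simp)).and (hΓe.eventually_nhds.and
    (hsymm'.and (hWe.and (H.open_source.mem_nhds hHs))))
  obtain ⟨s, hs, hball⟩ := Metric.eventually_nhds_iff_ball.1 hall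
  have hsub : ball p s ×ˢ ball (0 : REuc N) s ⊆ ball ((p, 0) : REuc N × REuc N) s := by
    rw [ball_prod_same]
  have hopen : IsOpen (ball p s ×ˢ ball (0 : REuc N) s) := isOpen_ball.prod isOpen_ball
  let D := H.restrOpen _ hopen
  have hD : D.source = ball p s ×ˢ ball (0 : REuc N) s := by
    rw [OpenPartialHomeomorph.restrOpen_source]
    exact inter_eq_right.2 fun z hz => (hball z (hsub hz)).2.2.2.2
  have hDz : ∀ z ∈ D.source, z ∈ ball ((p, 0) : REuc N × REuc N) s := fun z hz => by
    rw [hD] at hz; exact hsub hz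
  have hDH : ∀ z, D z = H z := fun _ => rfl
  have hmem : (p, (0 : REuc N)) ∈ D.source := by
    rw [hD]; exact ⟨mem_ball_self hs, mem_ball_self hs⟩
  refine ⟨{
    base := ball p s
    radius := s
    Γ := Γ
    chart := D
    isOpen_base := isOpen_ball
    mem_base := mem_ball_self hs
    radius_pos := hs
    source_eq := hD
    contDiffAt_Γ := fun z hz => (hball z (hDz z hz)).1
    mem := fun z hz => (hball z (hDz z hz)).2.2.2.1
    Γ_zero := fun z hz => UnitPath.extend_zero (hball z (hDz z hz)).2.1.self_of_nhds
    hasDeriv := fun z hz t ht => ?_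
    chart_apply := fun z => by rw [hDH, hH, ← hev]
    contDiffAt_symm := fun z hz => ?_
    mem_target := ?_
    Γ_center := hΓ₀
    hasDeriv_variation := fun z hz k t ht => ?_
    variation_zero := fun z hz k => ?_ }⟩
  · have := UnitPath.hasDerivWithinAt_extend (hball z (hDz z hz)).2.1.self_of_nhds ht
    rw [UnitPath.extend_of_mem (UnitPath.fieldAlong _ _ _) ht] at this
    rw [UnitPath.extend_of_mem _ ht]
    exact this
  · have h1 := (hball _ (hDz _ (D.map_target hz))).2.2.1
    have h2 : H (D.symm z) = z := D.right_inv hz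
    rwa [h2] at h1
  · have := D.map_source hmem
    rwa [hDH, hH, hG₀] at this
  · obtain ⟨g, hg, hgt⟩ := fderiv_flow_eq hf ((hball z (hDz z hz)).1.differentiableAt one_ne_zero)
      (hball z (hDz z hz)).2.1 (0, EuclideanSpace.single k 1)
    have := UnitPath.hasDerivWithinAt_extend hg ht
    rw [UnitPath.extend_of_mem g ht, hgt] at this
    rw [UnitPath.extend_of_mem (Γ z) ht, UnitPath.extend_of_mem (fderiv ℝ Γ z _) ht]
    exact this
  · obtain ⟨g, hg, hgt⟩ := fderiv_flow_eq hf ((hball z (hDz z hz)).1.differentiableAt one_ne_zero)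
      (hball z (hDz z hz)).2.1 (0, EuclideanSpace.single k 1)
    exact UnitPath.extend_zero hg

end LocalExponential

/-! ### The core estimate for two successive exponentials. -/

section QuasiTriangle

variable {N : ℕ}

lemma exists_norm_lt_of_abs_le (N : ℕ) {s : ℝ} (hs : 0 < s) :
    ∃ ε > 0, ∀ ξ : REuc N, (∀ k, |ξ k| ≤ ε) → ‖ξ‖ < s := by
  have hc : Continuous fun x : Fin N → ℝ => ‖(WithLp.toLp 2 x : REuc N)‖ :=
    continuous_norm.comp (PiLp.continuous_toLp 2 _)
  have h1 := (hc.continuousAt (x := 0)).eventually (gt_mem_nhds (by simpa using hs))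
  obtain ⟨ε, hε, h⟩ := Metric.eventually_nhds_iff.1 h1
  refine ⟨ε / 2, by positivity, fun ξ hξ => ?_⟩
  refine h (y := fun k => ξ k) ?_
  rw [dist_zero_right]
  refine ((pi_norm_le_iff_of_nonneg (by positivity)).2 hξ).trans_lt (by linarith)

namespace LocalExp

variable {Y : Fin N → REuc N → REuc N} {W : Set (REuc N)} {p : REuc N}

/-- `exp (∑ ξ_i Y_i) (u)` for `z = (u, ξ)`. -/
noncomputable def exp (L : LocalExp Y W p) (z : REuc N × REuc N) : REuc N := (L.Γ z).extend 1

lemma exists_ball_dist_lt (L : LocalExp Y W p) {s : ℝ} (hs : 0 < s) :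
    ∃ s' > 0, ∀ u ∈ ball p s', ∀ ξ ∈ ball (0 : REuc N) s', (u, ξ) ∈ L.chart.source ∧
      ∀ t, (L.Γ (u, ξ)).extend t ∈ ball p s := by
  have hmem : (p, (0 : REuc N)) ∈ L.chart.source := by
    rw [L.source_eq]; exact ⟨L.mem_base, mem_ball_self L.radius_pos⟩
  have h1 := (L.contDiffAt_Γ _ hmem).continuousAt.eventually (ball_mem_nhds _ hs)
  obtain ⟨s', hs', h⟩ := Metric.eventually_nhds_iff_ball.1
    (h1.and (L.chart.open_source.mem_nhds hmem))
  refine ⟨s', hs', fun u hu ξ hξ => ?_⟩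
  have h2 := h (u, ξ) (by rw [← ball_prod_same]; exact ⟨hu, hξ⟩)
  refine ⟨h2.2, fun t => ?_⟩
  have h3 : dist (L.Γ (u, ξ)) (UnitPath.constL _ p) < s := by
    rw [← L.Γ_center]; exact h2.1
  exact (ContinuousMap.dist_apply_le_dist (projIcc 0 1 zero_le_one t)).trans_lt h3

/-- The derivative of a curve in normal coordinates with respect to `u`, whose image under the
exponential map is an integral curve of `∑ η_i Y_i`. -/
lemma abs_deriv_coord_le {d : Fin N → ℕ} {C : ℝ} (h : IsGradedFrame d Y W C) (hC : 0 ≤ C)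
    (L : LocalExp Y W p) {ρ κ μ : ℝ} (hρ : 0 < ρ) (hρ1 : ρ ≤ 1) (hκ : 0 ≤ κ) (hμ : 0 ≤ μ)
    (hκC : N * (2 * (N * (N * (C * κ)))) ≤ 1 / 2) {u : REuc N} {η : REuc N} {ζ : ℝ → REuc N}
    {ζ' : REuc N} {t : ℝ} (ht : t ∈ Icc (0 : ℝ) 1) (hη : ∀ k, |η k| ≤ μ * ρ ^ d k)
    (hsrc : (u, ζ t) ∈ L.chart.source) (hζ : HasDerivWithinAt ζ ζ' (Icc 0 1) t)
    (hy : HasDerivWithinAt (fun t => L.exp (u, ζ t)) (frameField Y (η, L.exp (u, ζ t))) (Icc 0 1) t)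
    (hζt : ∀ k, |ζ t k| ≤ κ * ρ ^ d k) (k : Fin N) : |ζ' k| ≤ 2 * μ * ρ ^ d k := by
  set z := (u, ζ t)
  have hκC' : N * (N * (C * κ)) ≤ 1 := by
    rcases Nat.eq_zero_or_pos N with h0 | h0
    · subst h0; simp
    · have : (1 : ℝ) ≤ N := by exact_mod_cast h0
      have h2 : 0 ≤ N * (N * (C * κ)) := by positivity
      nlinarith
  have hB : ∀ k, ∃ B : Fin N → ℝ,
      (fderiv ℝ L.Γ z (0, EuclideanSpace.single k 1)).extend 1 = ∑ l, B l • Y l (L.exp z) ∧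
      ∀ l, |B l - (if l = k then 1 else 0)| * ρ ^ d k ≤ 2 * (N * (N * (C * κ))) * ρ ^ d l := by
    intro k
    refine h.exists_weighted_coords hC hρ hρ1 hκ hκC' hζt k (γ := (L.Γ z).extend)
      (L.hasDeriv z hsrc) (L.hasDeriv_variation z hsrc k) (L.variation_zero z hsrc k)
      (fun t ht => L.mem z hsrc _)
  choose B hB1 hB2 using hB
  let ev : UnitPath (REuc N) →L[ℝ] REuc N :=
    ContinuousMap.evalCLM ℝ (projIcc (0 : ℝ) 1 zero_le_one 1)
  have hd : HasDerivWithinAt (fun t => L.exp (u, ζ t)) (ev (fderiv ℝ L.Γ z (0, ζ'))) (Icc 0 1) t := by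
    have h1 := ((L.contDiffAt_Γ z hsrc).differentiableAt one_ne_zero).hasFDerivAt
    have h2 : HasDerivWithinAt (fun t => (u, ζ t)) (0, ζ') (Icc 0 1) t :=
      (hasDerivWithinAt_const t _ u).prodMk hζ
    exact ev.hasFDerivAt.comp_hasDerivWithinAt t
      (HasFDerivAt.comp_hasDerivWithinAt t (f := fun t => (u, ζ t)) h1 h2)
  -- The velocity is computed twice, by the chain rule through the exponential map and from the
  -- field; comparing frame coordinates gives the linear system ∑ ζ'_k B_kl = η_l.
  have heq := (uniqueDiffOn_Icc zero_lt_one t ht).eq_deriv _ hd hy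
  have hsum : ((0 : REuc N), ζ') = ∑ k, ζ' k • ((0 : REuc N), EuclideanSpace.single k (1 : ℝ)) := by
    refine Prod.ext (by simp [Prod.fst_sum]) ?_
    rw [Prod.snd_sum]
    ext j
    simp [Pi.single_apply]
  have hlin : ∑ l, (∑ k, ζ' k * B k l) • Y l (L.exp z) = ∑ l, η l • Y l (L.exp z) := by
    have e1 : ev (fderiv ℝ L.Γ z (0, ζ')) = ∑ k, ζ' k • ∑ l, B k l • Y l (L.exp z) := by
      rw [hsum, map_sum, map_sum]
      refine Finset.sum_congr rfl fun k _ => ?_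
      rw [map_smul, map_smul, ← hB1]
      rfl
    have e2 : ∑ l, η l • Y l (L.exp z) = frameField Y (η, L.exp (u, ζ t)) := rfl
    rw [e2, ← heq, e1]
    simp only [Finset.smul_sum, Finset.sum_smul, smul_smul]
    rw [Finset.sum_comm]
  have hη' : ∀ l, ∑ k, ζ' k * B k l = η l := fun l => by
    have h3 := Fintype.linearIndependent_iff.1 (h.linearIndependent _ (L.mem z hsrc _))
      (fun l => (∑ k, ζ' k * B k l) - η l)
      (by simp only [sub_smul, Finset.sum_sub_distrib]; exact sub_eq_zero.2 hlin) l
    exact sub_eq_zero.1 h3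
  exact weighted_inverse_bound d hρ hκC hμ hB2 hη' hη k

/-- If `v = exp η (exp ξ u)` and `|ξ_k|, |η_k| ≤ ε ^ d k`, then `v = exp ζ u` with
`|ζ_k| ≤ (C' ε) ^ d k`. -/
theorem exists_quasi_triangle {d : Fin N → ℕ} (hd : ∀ k, 1 ≤ d k) {C : ℝ}
    (h : IsGradedFrame d Y W C) (hC : 0 ≤ C) (L : LocalExp Y W p) :
    ∃ C' > 0, ∃ ε₀ > 0, ∃ s > 0, ball p s ⊆ L.base ∧ ∀ u ∈ ball p s, ∀ ξ η : REuc N, ∀ ε, 0 < ε →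
      ε ≤ ε₀ → (∀ k, |ξ k| ≤ ε ^ d k) → (∀ k, |η k| ≤ ε ^ d k) →
      (u, ξ) ∈ L.chart.source ∧ (L.exp (u, ξ), η) ∈ L.chart.source ∧
      ∃ ζ, (u, ζ) ∈ L.chart.source ∧ (∀ k, |ζ k| ≤ (C' * ε) ^ d k) ∧
        L.exp (L.exp (u, ξ), η) = L.exp (u, ζ) := by
  -- Radii are chosen backwards: pairs in the `s₁`-ball have normal coordinates, curves from the
  -- `s₂`-ball stay in the `s₁`-ball, and curves from the `s₃`-ball stay in the `s₂`-ball.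
  obtain ⟨s₁, hs₁, hsT⟩ := Metric.isOpen_iff.1 L.chart.open_target _ L.mem_target
  rw [← ball_prod_same] at hsT
  obtain ⟨s₂, hs₂, h₂⟩ := L.exists_ball_dist_lt hs₁
  obtain ⟨s₃, hs₃, h₃⟩ := L.exists_ball_dist_lt hs₂
  let s := min s₁ (min s₂ s₃)
  have hs : 0 < s := by positivity
  have hss₁ : s ≤ s₁ := min_le_left _ _
  have hss₂ : s ≤ s₂ := (min_le_right _ _).trans (min_le_left _ _)
  have hss₃ : s ≤ s₃ := (min_le_right _ _).trans (min_le_right _ _)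
  obtain ⟨ε₁, hε₁, hnorm⟩ := exists_norm_lt_of_abs_le N hs
  -- The first summand of the denominator makes 2N³Cκ ≤ 1/2; the 4 keeps it positive and gives κ ≤
  -- 1/4.
  let κ : ℝ := 1 / (4 * N * N * N * C + 4)
  have hden : (0 : ℝ) < 4 * N * N * N * C + 4 := by positivity
  have hκ : 0 < κ := by positivity
  have hκC : N * (2 * (N * (N * (C * κ)))) ≤ 1 / 2 := by
    have : N * (2 * (N * (N * (C * κ)))) = (2 * N * N * N * C) / (4 * N * N * N * C + 4) := by
      simp only [κ]; ring
    rw [this, div_le_iff₀ hden]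
    linarith
  have hκ4 : κ ≤ 1 / 4 := by
    simp only [κ]
    exact one_div_le_one_div_of_le (by norm_num) (by
      have : (0 : ℝ) ≤ 4 * N * N * N * C := by positivity
      linarith)
  -- In rescaled coordinates the curve starts within μ of 0 and its barrier grows at rate 3μ, so the
  -- barrier reaches 4μ = κ at time 1.
  let μ : ℝ := κ / 4
  have hμ : 0 < μ := by positivity
  have hμ1 : μ ≤ 1 := by simp only [μ]; linarith
  refine ⟨1 / μ, by positivity, min (min ε₁ 1) μ, by positivity, s, hs, fun u hu => ?_, ?_⟩
  · have := (h₂ u (ball_subset_ball hss₂ hu) 0 (mem_ball_self hs₂)).1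
    rw [L.source_eq] at this
    exact this.1
  intro u hu ξ η ε hε hεε hξ hη
  have hε1 : ε ≤ 1 := hεε.trans ((min_le_left _ _).trans (min_le_right _ _))
  have hεle : ε ≤ ε₁ := hεε.trans ((min_le_left _ _).trans (min_le_left _ _))
  have hεμ : ε ≤ μ := hεε.trans (min_le_right _ _)
  have hpow : ∀ k, ε ^ d k ≤ ε := fun k =>
    pow_le_of_le_one hε.le hε1 (Nat.one_le_iff_ne_zero.1 (hd k))
  have hξs : ξ ∈ ball (0 : REuc N) s :=
    mem_ball_zero_iff.2 (hnorm ξ fun k => (hξ k).trans ((hpow k).trans hεle))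
  have hηs : η ∈ ball (0 : REuc N) s :=
    mem_ball_zero_iff.2 (hnorm η fun k => (hη k).trans ((hpow k).trans hεle))
  obtain ⟨hsrc, hw⟩ := h₃ u (ball_subset_ball hss₃ hu) ξ (ball_subset_ball hss₃ hξs)
  set w := L.exp (u, ξ)
  obtain ⟨hsrc', hy⟩ := h₂ w (hw 1) η (ball_subset_ball hss₂ hηs)
  refine ⟨hsrc, hsrc', ?_⟩
  set y := (L.Γ (w, η)).extend
  have hyT : ∀ t, (u, y t) ∈ L.chart.target := fun t => hsT ⟨ball_subset_ball hss₁ hu, hy t⟩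
  let ζ : ℝ → REuc N := fun t => (L.chart.symm (u, y t)).2
  have hinv : ∀ t, L.chart.symm (u, y t) = (u, ζ t) ∧ L.exp (u, ζ t) = y t := fun t => by
    have h1 := L.chart.right_inv (hyT t)
    rw [L.chart_apply] at h1
    have h2 : L.chart.symm (u, y t) = (u, ζ t) := by
      have h3 : (L.chart.symm (u, y t)).1 = u := congrArg Prod.fst h1
      exact Prod.ext h3 rfl
    refine ⟨h2, ?_⟩
    rw [← h2]
    exact congrArg Prod.snd h1
  have hζsrc : ∀ t, (u, ζ t) ∈ L.chart.source := fun t => by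
    rw [← (hinv t).1]; exact L.chart.map_target (hyT t)
  have hyd := L.hasDeriv (w, η) hsrc'
  have hζd : ∀ t ∈ Icc (0 : ℝ) 1, ∃ ζ', HasDerivWithinAt ζ ζ' (Icc 0 1) t := fun t ht => by
    have h1 := ((L.contDiffAt_symm _ (hyT t)).differentiableAt one_ne_zero).hasFDerivAt
    have h2 : HasDerivWithinAt (fun t => (u, y t)) (0, frameField Y (η, y t)) (Icc 0 1) t :=
      (hasDerivWithinAt_const t _ u).prodMk (hyd t ht)
    exact ⟨_, hasFDerivAt_snd.comp_hasDerivWithinAt t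
      (HasFDerivAt.comp_hasDerivWithinAt t (f := fun t => (u, y t)) h1 h2)⟩
  choose! ζ' hζ' using hζd
  -- As μ ≤ 1 and d_k ≥ 1, ε^{d_k} = (μρ)^{d_k} ≤ μ ρ^{d_k}: enlarging the scale from ε to ρ gains
  -- the factor μ in every component.
  let ρ : ℝ := ε / μ
  have hρ : 0 < ρ := by positivity
  have hρ1 : ρ ≤ 1 := (div_le_one hμ).2 hεμ
  have hερ : ∀ k, ε ^ d k ≤ μ * ρ ^ d k := fun k => by
    have : ε = μ * ρ := by simp only [ρ]; field_simp
    rw [this, mul_pow]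
    exact mul_le_mul_of_nonneg_right
      (pow_le_of_le_one hμ.le hμ1 (Nat.one_le_iff_ne_zero.1 (hd k))) (by positivity)
  have hpos (m : ℕ) : 0 < ρ ^ m := pow_pos hρ m
  have hζ0 : ζ 0 = ξ := by
    have h1 : y 0 = w := L.Γ_zero (w, η) hsrc'
    have h2 := L.chart.left_inv hsrc
    rw [L.chart_apply] at h2
    simp only [ζ]
    rw [h1]
    exact congrArg Prod.snd h2
  let f : ℝ → Fin N → ℝ := fun t k => ζ t k / ρ ^ d k
  let f' : ℝ → Fin N → ℝ := fun t k => ζ' t k / ρ ^ d k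
  have hf : ∀ t ∈ Icc (0 : ℝ) 1, HasDerivWithinAt f (f' t) (Icc 0 1) t := fun t ht =>
    hasDerivWithinAt_pi.2 fun k => HasDerivWithinAt.div_const
      ((EuclideanSpace.proj (𝕜 := ℝ) k).hasFDerivAt.comp_hasDerivWithinAt t (hζ' t ht)) _
  have hfle : ∀ t c, 0 ≤ c → (‖f t‖ ≤ c ↔ ∀ k, |ζ t k| ≤ c * ρ ^ d k) := fun t c hc => by
    rw [pi_norm_le_iff_of_nonneg hc]
    refine forall_congr' fun k => ?_
    simp only [f, Real.norm_eq_abs, abs_div, abs_of_pos (hpos _)]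
    exact div_le_iff₀ (hpos _)
  -- The velocity bound is known only while ‖f‖ ≤ κ. It is needed only when ‖f‖ meets the barrier μ
  -- + 3μt ≤ κ, and there the speed is at most 2μ < 3μ.
  have hbound := image_norm_le_of_norm_deriv_right_lt_deriv_boundary (f := f) (f' := f') (a := 0)
    (b := 1) (B := fun t => μ + 3 * μ * t) (B' := fun _ => 3 * μ)
    (fun t ht => (hf t ht).continuousWithinAt)
    (fun t ht => (hf t (Ico_subset_Icc_self ht)).mono_of_mem_nhdsWithin
      (Icc_mem_nhdsGE_of_mem ht))
    (by
      rw [hfle _ _ (by simpa using hμ.le), hζ0]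
      intro k
      simpa using (hξ k).trans (hερ k))
    (fun t => by simpa using ((hasDerivAt_id t).const_mul (3 * μ)).const_add μ)
    (fun t ht hft => by
      have ht' : t ∈ Icc (0 : ℝ) 1 := Ico_subset_Icc_self ht
      have h1 : ‖f t‖ ≤ κ := by
        rw [hft]
        have : 3 * μ * t ≤ 3 * μ := mul_le_of_le_one_right (by positivity) ht.2.le
        simp only [μ] at this ⊢
        linarith
      have h2 := (hfle t κ hκ.le).1 h1
      have h3 : ∀ k, |ζ' t k| ≤ 2 * μ * ρ ^ d k := by
        refine abs_deriv_coord_le h hC L hρ hρ1 hκ.le hμ.le hκC ht'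
          (fun k => (hη k).trans (hερ k)) (hζsrc t) (hζ' t ht') ?_ h2
        simp only [(hinv _).2]
        exact hyd t ht'
      have h4 : ‖f' t‖ ≤ 2 * μ := by
        refine (pi_norm_le_iff_of_nonneg (by positivity)).2 fun k => ?_
        simp only [f', Real.norm_eq_abs, abs_div, abs_of_pos (hpos _)]
        exact (div_le_iff₀ (hpos _)).2 (h3 k)
      linarith)
  refine ⟨ζ 1, hζsrc 1, fun k => ?_, ((hinv 1).2).symm⟩
  have h1 := (hfle 1 1 zero_le_one).1 ((hbound ⟨zero_le_one, le_rfl⟩).trans (by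
    simp only [μ]; linarith)) k
  rw [one_mul] at h1
  have h2 : 1 / μ * ε = ρ := by simp only [ρ]; ring
  rwa [h2]

end LocalExp

end QuasiTriangle

/-! ### Transfer of the frame and of integral curves to a chart of the manifold. -/

section ChartFrame

variable {N : ℕ} {M : Type*} [TopologicalSpace M] [ChartedSpace (REuc N) M]

/-- `Z` is a graded frame on an open set `W` in the chart at `p`, whose image on `M` is `X`. -/
structure IsChartFrame (F : FiltrationDims N) (V : Set M)
    (X : Fin N → (x : M) → TangentSpace (𝓡 N) x) (p : M)
    (Z : Fin N → REuc N → REuc N) (W : Set (REuc N)) (C : ℝ) : Prop where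
  graded : IsGradedFrame F.deg Z W C
  nonneg : 0 ≤ C
  mem : extChartAt (𝓡 N) p p ∈ W
  subset_target : W ⊆ (extChartAt (𝓡 N) p).target
  mapsTo : ∀ y ∈ W, (extChartAt (𝓡 N) p).symm y ∈ V
  mfderiv_symm : ∀ i, ∀ y ∈ W, mfderiv 𝓘(ℝ, REuc N) (𝓡 N) (extChartAt (𝓡 N) p).symm y (Z i y)
    = X i ((extChartAt (𝓡 N) p).symm y)

/-- The domain of the chart at `p`, restricted to `V`. -/
def chartDomain (V : Set M) (p : M) : Set (REuc N) :=
  (extChartAt (𝓡 N) p).target ∩ (extChartAt (𝓡 N) p).symm ⁻¹' V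

/-- The derivative of the inverse of the chart at `p`. -/
noncomputable def chartSymmDeriv (p : M) (y : REuc N) : REuc N →L[ℝ] REuc N :=
  mfderiv 𝓘(ℝ, REuc N) (𝓡 N) (extChartAt (𝓡 N) p).symm y

/-- The field `X` in the chart at `p`. -/
noncomputable def chartField (X : (x : M) → TangentSpace (𝓡 N) x) (p : M) (y : REuc N) : REuc N :=
  VectorField.mpullback 𝓘(ℝ, REuc N) (𝓡 N) (extChartAt (𝓡 N) p).symm X y

lemma chartField_eq (X : (x : M) → TangentSpace (𝓡 N) x) (p : M) (y : REuc N) :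
    chartField X p y = (chartSymmDeriv p y).inverse (X ((extChartAt (𝓡 N) p).symm y)) := rfl

variable {F : FiltrationDims N} {V : Set M} {X : Fin N → (x : M) → TangentSpace (𝓡 N) x}

lemma IsChartFrame.chartSymmDeriv_frameField {p : M}
    {Z : Fin N → REuc N → REuc N} {W : Set (REuc N)} {C : ℝ}
    (h : IsChartFrame F V X p Z W C) (ξ : REuc N) {y : REuc N}
    (hy : y ∈ W) :
    chartSymmDeriv p y (frameField Z (ξ, y)) = ∑ i, ξ i • X i ((extChartAt (𝓡 N) p).symm y) := by
  rw [frameField, map_sum]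
  refine Finset.sum_congr rfl fun i _ => ?_
  rw [← h.mfderiv_symm i y hy, map_smul]
  rfl

variable [IsManifold (𝓡 N) ∞ M]

lemma contMDiffAt_chart_symm {p : M} {y : REuc N} (hy : y ∈ (extChartAt (𝓡 N) p).target) :
    ContMDiffAt 𝓘(ℝ, REuc N) (𝓡 N) ∞ (extChartAt (𝓡 N) p).symm y :=
  (contMDiffOn_extChartAt_symm p).contMDiffAt ((isOpen_extChartAt_target p).mem_nhds hy)

lemma isInvertible_mfderiv_chart_symm {p : M} {y : REuc N}
    (hy : y ∈ (extChartAt (𝓡 N) p).target) :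
    (mfderiv 𝓘(ℝ, REuc N) (𝓡 N) (extChartAt (𝓡 N) p).symm y).IsInvertible := by
  have h1 : IsManifold (𝓡 N) 1 M := IsManifold.of_le (n := ∞) (by simp)
  have := isInvertible_mfderivWithin_extChartAt_symm (I := 𝓡 N) hy
  rwa [ModelWithCorners.range_eq_univ, mfderivWithin_univ] at this

lemma IsCarnotFrame.contMDiffAt (hX : IsCarnotFrame F V X) (i : Fin N) {v : M} (hv : v ∈ V) :
    ContMDiffAt (𝓡 N) (𝓡 N).tangent 1 (fun x => (⟨x, X i x⟩ : TangentBundle (𝓡 N) M)) v :=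
  (hX.contMDiffOn i).contMDiffAt (hX.isOpen.mem_nhds hv)

lemma chartSymmDeriv_chartField (X : (x : M) → TangentSpace (𝓡 N) x) {p : M} {y : REuc N}
    (hy : y ∈ (extChartAt (𝓡 N) p).target) :
    chartSymmDeriv p y (chartField X p y) = X ((extChartAt (𝓡 N) p).symm y) := by
  obtain ⟨e, he⟩ : (chartSymmDeriv p y).IsInvertible := isInvertible_mfderiv_chart_symm hy
  rw [chartField_eq, ← he, ContinuousLinearMap.inverse_equiv]
  exact e.apply_symm_apply _

lemma IsCarnotFrame.contDiffOn_chartField (hX : IsCarnotFrame F V X) (p : M) (i : Fin N) :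
    ContDiffOn ℝ 1 (chartField (X i) p) (chartDomain V p) := fun y hy => by
  have h1 := ContMDiffAt.mpullback_vectorField_preimage (hX.contMDiffAt i hy.2)
    (contMDiffAt_chart_symm hy.1) (isInvertible_mfderiv_chart_symm hy.1) (by norm_cast)
  exact (contMDiffAt_vectorSpace_iff_contDiffAt.1 h1).contDiffWithinAt

lemma IsCarnotFrame.linearIndependent_chartField (hX : IsCarnotFrame F V X) (p : M)
    {y : REuc N} (hy : y ∈ chartDomain V p) :
    LinearIndependent ℝ fun i => chartField (X i) p y := by
  rw [Fintype.linearIndependent_iff]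
  intro c hc
  refine Fintype.linearIndependent_iff.1 (hX.linearIndependent _ hy.2) c ?_
  have h1 := congrArg (chartSymmDeriv p y) hc
  rw [map_sum, map_zero] at h1
  refine Eq.trans (Finset.sum_congr rfl fun i _ => ?_) h1
  rw [map_smul, chartSymmDeriv_chartField _ hy.1]
  rfl

/-- Pullback commutes with brackets and is linear at each point, so the structure coefficients are
unchanged. -/
lemma IsCarnotFrame.lieBracket_chartField (hX : IsCarnotFrame F V X) (p : M) (i j : Fin N)
    {y : REuc N} (hy : y ∈ chartDomain V p) : ∃ c : Fin N → ℝ,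
      VectorField.lieBracket ℝ (chartField (X i) p) (chartField (X j) p) y
      = ∑ k with F.deg k ≤ F.deg i + F.deg j, c k • chartField (X k) p y := by
  obtain ⟨c, hc⟩ := hX.bracket i j _ hy.2
  refine ⟨c, ?_⟩
  have hM : IsManifold (𝓡 N) (minSmoothness ℝ 2) M := by
    rw [minSmoothness_of_isRCLikeNormedField]
    exact IsManifold.of_le (n := ∞) (by norm_cast)
  have h1 := VectorField.mpullback_mlieBracket (n := ∞)
    ((hX.contMDiffAt i hy.2).mdifferentiableAt one_ne_zero)
    ((hX.contMDiffAt j hy.2).mdifferentiableAt one_ne_zero)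
    (contMDiffAt_chart_symm hy.1) (by
      rw [minSmoothness_of_isRCLikeNormedField]; norm_cast)
  have h2 : ∀ A B : (x : REuc N) → TangentSpace 𝓘(ℝ, REuc N) x,
      VectorField.mlieBracket 𝓘(ℝ, REuc N) A B y = VectorField.lieBracket ℝ A B y := fun A B => by
    rw [← VectorField.mlieBracketWithin_univ, VectorField.mlieBracketWithin_eq_lieBracketWithin]
    exact congrFun (VectorField.lieBracketWithin_univ (𝕜 := ℝ) (V := A) (W := B)) y
  have h3 : (chartSymmDeriv p y).inverse
      (VectorField.mlieBracket (𝓡 N) (X i) (X j) ((extChartAt (𝓡 N) p).symm y))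
      = ∑ k with F.deg k ≤ F.deg i + F.deg j, c k • chartField (X k) p y := by
    rw [hc]
    refine (map_sum (chartSymmDeriv p y).inverse _ _).trans (Finset.sum_congr rfl fun k _ => ?_)
    rw [chartField_eq]
    exact map_smul (chartSymmDeriv p y).inverse (c k) _
  exact (h2 _ _).symm.trans (h1.symm.trans h3)

theorem exists_isChartFrame (hX : IsCarnotFrame F V X) {p : M} (hp : p ∈ V) :
    ∃ Z W C, IsChartFrame F V X p Z W C := by
  have hW₀ : IsOpen (chartDomain (N := N) V p) :=
    (continuousOn_extChartAt_symm p).isOpen_inter_preimage (isOpen_extChartAt_target p) hX.isOpen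
  have hpW : extChartAt (𝓡 N) p p ∈ chartDomain V p := ⟨mem_extChartAt_target p, by
    rw [mem_preimage, extChartAt_to_inv]; exact hp⟩
  obtain ⟨Z, W, C, hgr, hC, hpW', hsub, hZY⟩ := exists_isGradedFrame hW₀
    (hX.contDiffOn_chartField p) (fun y hy => hX.linearIndependent_chartField p hy)
    (fun i j y hy => hX.lieBracket_chartField p i j hy) hpW
  exact ⟨Z, W, C, hgr, hC, hpW', fun y hy => (hsub hy).1, fun y hy => (hsub hy).2,
    fun i y hy => by rw [hZY i hy]; exact chartSymmDeriv_chartField (X i) (hsub hy).1⟩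

namespace IsChartFrame

variable {p : M} {Z : Fin N → REuc N → REuc N} {W : Set (REuc N)} {C : ℝ}

/-- The image of an integral curve in the chart is an integral curve. -/
lemma hasMFDerivWithinAt_symm (h : IsChartFrame F V X p Z W C) {c : ℝ → REuc N} {ξ : REuc N}
    {s : Set ℝ} {t : ℝ} (hc : HasDerivWithinAt c (frameField Z (ξ, c t)) s t) (hcW : c t ∈ W) :
    HasMFDerivWithinAt 𝓘(ℝ, ℝ) (𝓡 N) (fun t => (extChartAt (𝓡 N) p).symm (c t)) s t
      ((1 : ℝ →L[ℝ] ℝ).smulRight (∑ i, ξ i • X i ((extChartAt (𝓡 N) p).symm (c t)))) := by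
  have h1 := ((contMDiffAt_chart_symm (h.subset_target hcW)).mdifferentiableAt
    (by simp)).hasMFDerivAt
  have h2 := h1.comp_hasMFDerivWithinAt t hc.hasFDerivWithinAt.hasMFDerivWithinAt
  have h3 : (chartSymmDeriv p (c t)).comp
      (ContinuousLinearMap.toSpanSingleton ℝ (frameField Z (ξ, c t)))
      = (1 : ℝ →L[ℝ] ℝ).smulRight (chartSymmDeriv p (c t) (frameField Z (ξ, c t))) := by
    ext; simp
  rw [h.chartSymmDeriv_frameField ξ hcW] at h3
  exact h2.congr_mfderiv h3

/-- An integral curve is an integral curve in the chart. -/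
lemma hasDerivWithinAt_chart (h : IsChartFrame F V X p Z W C) {γ : ℝ → M} {ξ : REuc N}
    {s : Set ℝ} {t : ℝ} (hγ : HasMFDerivWithinAt 𝓘(ℝ, ℝ) (𝓡 N) γ s t
      ((1 : ℝ →L[ℝ] ℝ).smulRight (∑ i, ξ i • X i (γ t))))
    (hsrc : γ t ∈ (extChartAt (𝓡 N) p).source) (hW : extChartAt (𝓡 N) p (γ t) ∈ W) :
    HasDerivWithinAt (fun t => extChartAt (𝓡 N) p (γ t))
      (frameField Z (ξ, extChartAt (𝓡 N) p (γ t))) s t := by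
  have hM : IsManifold (𝓡 N) 1 M := IsManifold.of_le (n := ∞) (by simp)
  have h1 := (mdifferentiableAt_extChartAt (I := 𝓡 N) (x := p) (y := γ t)
    (by rwa [extChartAt_source] at hsrc)).hasMFDerivAt
  have h2 := (h1.comp_hasMFDerivWithinAt t hγ).hasFDerivWithinAt
  let D : REuc N →L[ℝ] REuc N := mfderiv (𝓡 N) 𝓘(ℝ, REuc N) (extChartAt (𝓡 N) p) (γ t)
  let v : REuc N := ∑ i, ξ i • X i (γ t)
  have h2' : HasFDerivWithinAt (fun t => extChartAt (𝓡 N) p (γ t))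
      (D.comp ((1 : ℝ →L[ℝ] ℝ).smulRight v)) s t := h2
  have h3 := mfderiv_extChartAt_comp_mfderivWithin_extChartAt_symm (I := 𝓡 N)
    (h.subset_target hW)
  rw [ModelWithCorners.range_eq_univ, mfderivWithin_univ, (extChartAt (𝓡 N) p).left_inv hsrc] at h3
  have h3' : D.comp (chartSymmDeriv p (extChartAt (𝓡 N) p (γ t))) =
    ContinuousLinearMap.id ℝ (REuc N) := h3
  have h4 : D (chartSymmDeriv p (extChartAt (𝓡 N) p (γ t))
      (frameField Z (ξ, extChartAt (𝓡 N) p (γ t)))) = frameField Z (ξ, extChartAt (𝓡 N) p (γ t)) :=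
    congrArg (fun T : REuc N →L[ℝ] REuc N => T (frameField Z (ξ, extChartAt (𝓡 N) p (γ t)))) h3'
  have h5 : chartSymmDeriv p (extChartAt (𝓡 N) p (γ t))
      (frameField Z (ξ, extChartAt (𝓡 N) p (γ t))) = v := by
    have := h.chartSymmDeriv_frameField ξ hW
    rwa [(extChartAt (𝓡 N) p).left_inv hsrc] at this
  rw [h5] at h4
  rw [hasDerivWithinAt_iff_hasFDerivWithinAt]
  refine h2'.congr_fderiv ?_
  ext
  simp [h4]

end IsChartFrame

end ChartFrame

/-! ### Reparametrization and uniqueness of integral curves on the manifold. -/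

section ExpCurve

variable {N : ℕ} {M : Type*} [TopologicalSpace M] [ChartedSpace (REuc N) M]
  {V : Set M} {X : Fin N → (x : M) → TangentSpace (𝓡 N) x}

/-- `c` is an integral curve of `∑ ξ_i X_i` in `V`, for times in `[0, 1]`. -/
structure IsExpCurve (V : Set M) (X : Fin N → (x : M) → TangentSpace (𝓡 N) x) (ξ : REuc N)
    (c : ℝ → M) : Prop where
  mem : ∀ t ∈ Icc (0 : ℝ) 1, c t ∈ V
  integral : IsMIntegralCurveOn c (fun x => ∑ i, ξ i • X i x) (Icc 0 1)

lemma isExp_iff {u v : M} {ξ : REuc N} :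
    IsExp V X u ξ v ↔ ∃ c, IsExpCurve V X ξ c ∧ c 0 = u ∧ c 1 = v :=
  ⟨fun ⟨c, h0, h1, hV, hi⟩ => ⟨c, ⟨hV, hi⟩, h0, h1⟩, fun ⟨c, ⟨hV, hi⟩, h0, h1⟩ => ⟨c, h0, h1, hV, hi⟩⟩

namespace IsExpCurve

variable {ξ : REuc N} {c : ℝ → M}

lemma continuousOn (h : IsExpCurve V X ξ c) : ContinuousOn c (Icc 0 1) :=
  fun t ht => (h.integral t ht).continuousWithinAt

lemma affine_mem {a b : ℝ} (ha : a ∈ Icc (0 : ℝ) 1) (hb : b ∈ Icc (0 : ℝ) 1) {t : ℝ}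
    (ht : t ∈ Icc (0 : ℝ) 1) : a + t * (b - a) ∈ Icc (0 : ℝ) 1 := by
  have := (convex_Icc (0 : ℝ) 1) ha hb (sub_nonneg.2 ht.2) ht.1 (by ring)
  have e : (1 - t) • a + t • b = a + t * (b - a) := by simp only [smul_eq_mul]; ring
  rwa [e] at this

/-- Affine changes of the time. -/
lemma affine (h : IsExpCurve V X ξ c) {a b : ℝ} (ha : a ∈ Icc (0 : ℝ) 1) (hb : b ∈ Icc (0 : ℝ) 1) :
    IsExpCurve V X ((b - a) • ξ) (fun t => c (a + t * (b - a))) where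
  mem t ht := h.mem _ (affine_mem ha hb ht)
  integral t ht := by
    have h1 := h.integral _ (affine_mem ha hb ht)
    have h2 : HasFDerivWithinAt (fun t : ℝ => a + t * (b - a))
        ((1 : ℝ →L[ℝ] ℝ).smulRight (b - a)) (Icc 0 1) t := by
      have := ((hasDerivAt_id t).mul_const (b - a)).const_add a
      rw [one_mul] at this
      refine this.hasDerivWithinAt.hasFDerivWithinAt.congr_fderiv ?_
      ext; simp
    have hmaps : Icc (0 : ℝ) 1 ⊆ (fun t : ℝ => a + t * (b - a)) ⁻¹' Icc 0 1 :=
      fun t ht => affine_mem ha hb ht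
    have h3 := h1.comp t h2.hasMFDerivWithinAt hmaps
    refine h3.congr_mfderiv ?_
    let x : Fin N → REuc N := fun i => X i (c (a + t * (b - a)))
    let v : REuc N := ∑ i, ξ i • x i
    have e1 : ∑ i, ((b - a) • ξ) i • x i = (b - a) • v := by
      simp only [v, Finset.smul_sum, smul_smul, PiLp.smul_apply, smul_eq_mul]
    have e2 : ((1 : ℝ →L[ℝ] ℝ).smulRight v).comp ((1 : ℝ →L[ℝ] ℝ).smulRight (b - a))
        = (1 : ℝ →L[ℝ] ℝ).smulRight ((b - a) • v) := by
      ext; simp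
    rw [← e1] at e2
    exact e2

lemma isExp_affine (h : IsExpCurve V X ξ c) {a b : ℝ} (ha : a ∈ Icc (0 : ℝ) 1)
    (hb : b ∈ Icc (0 : ℝ) 1) : IsExp V X (c a) ((b - a) • ξ) (c b) :=
  isExp_iff.2 ⟨_, h.affine ha hb, by simp, by simp⟩

end IsExpCurve

lemma IsExp.symm {u v : M} {ξ : REuc N} (h : IsExp V X u ξ v) : IsExp V X v (-ξ) u := by
  obtain ⟨c, hc, rfl, rfl⟩ := isExp_iff.1 h
  have := hc.isExp_affine (a := 1) (b := 0) ⟨zero_le_one, le_rfl⟩ ⟨le_rfl, zero_le_one⟩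
  rwa [zero_sub, neg_one_smul] at this

variable [IsManifold (𝓡 N) ∞ M] {F : FiltrationDims N}

lemma IsChartFrame.hasDerivWithinAt_expCurve {p : M} {Z : Fin N → REuc N → REuc N}
    {W : Set (REuc N)} {C : ℝ} (h : IsChartFrame F V X p Z W C) {ξ : REuc N} {c : ℝ → M}
    (hc : IsExpCurve V X ξ c)
    (hcW : ∀ t ∈ Icc (0 : ℝ) 1, c t ∈ (extChartAt (𝓡 N) p).source ∧ extChartAt (𝓡 N) p (c t) ∈ W)
    {t : ℝ} (ht : t ∈ Icc (0 : ℝ) 1) :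
    HasDerivWithinAt (fun t => extChartAt (𝓡 N) p (c t))
      (frameField Z (ξ, extChartAt (𝓡 N) p (c t))) (Icc 0 1) t :=
  h.hasDerivWithinAt_chart (hc.integral t ht) (hcW t ht).1 (hcW t ht).2

/-- Integral curves with a common point coincide near this point. -/
lemma IsCarnotFrame.eventually_eq_of_eq (hX : IsCarnotFrame F V X) {ξ : REuc N} {c c' : ℝ → M}
    (hc : IsExpCurve V X ξ c) (hc' : IsExpCurve V X ξ c') {t₀ : ℝ} (ht₀ : t₀ ∈ Icc (0 : ℝ) 1)
    (heq : c t₀ = c' t₀) : ∀ᶠ t in 𝓝[Icc 0 1] t₀, c t = c' t := by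
  obtain ⟨Z, W, C, h⟩ := exists_isChartFrame hX (hc.mem t₀ ht₀)
  set p := c t₀
  set φ := extChartAt (𝓡 N) p
  have hf := contDiff_frameField h.graded.contDiff
  obtain ⟨K, S, hS, hK⟩ : ∃ K : ℝ≥0, ∃ S ∈ 𝓝 (φ p), LipschitzOnWith K
      (fun y => frameField Z (ξ, y)) S :=
    (hf.comp (contDiff_const.prodMk contDiff_id) : ContDiff ℝ 1 fun y =>
      frameField Z (ξ, y)).contDiffAt.exists_lipschitzOnWith
  have hev : ∀ {c : ℝ → M}, IsExpCurve V X ξ c → c t₀ = p → ∀ᶠ t in 𝓝[Icc 0 1] t₀,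
      c t ∈ φ.source ∧ φ (c t) ∈ W ∩ S := fun {c} hc hcp => by
    have h1 : Filter.Tendsto c (𝓝[Icc 0 1] t₀) (𝓝 p) := by
      rw [← hcp]; exact hc.continuousOn t₀ ht₀
    have h2 := h1.eventually (extChartAt_source_mem_nhds (I := 𝓡 N) p)
    have h3 := (continuousAt_extChartAt (I := 𝓡 N) p).tendsto.comp h1
    exact h2.and (h3.eventually (Filter.inter_mem (h.graded.isOpen.mem_nhds h.mem) hS))
  have hall := (hev hc rfl).and (hev hc' heq.symm)
  rw [eventually_nhdsWithin_iff, Metric.eventually_nhds_iff_ball] at hall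
  obtain ⟨δ, hδ, hδ'⟩ := hall
  rw [eventually_nhdsWithin_iff]
  filter_upwards [ball_mem_nhds t₀ hδ] with t htδ ht
  have hsub : ∀ s ∈ Icc (0 : ℝ) 1, t₀ + s * (t - t₀) ∈ ball t₀ δ := fun s hs => by
    rw [mem_ball, Real.dist_eq] at htδ ⊢
    rw [add_sub_cancel_left, abs_mul, abs_of_nonneg hs.1]
    exact (mul_le_of_le_one_left (abs_nonneg _) hs.2).trans_lt htδ
  have hmem : ∀ s ∈ Icc (0 : ℝ) 1, _ := fun s hs =>
    hδ' _ (hsub s hs) (IsExpCurve.affine_mem ht₀ ht hs)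
  -- The segment from `t₀` to `t` is rescaled to [0, 1], with ξ replaced by (t - t₀) ξ. Forward
  -- uniqueness then covers t < t₀ as well.
  have hd := fun s (hs : s ∈ Icc (0 : ℝ) 1) => h.hasDerivWithinAt_expCurve (hc.affine ht₀ ht)
    (fun s hs => ⟨(hmem s hs).1.1, (hmem s hs).1.2.1⟩) hs
  have hd' := fun s (hs : s ∈ Icc (0 : ℝ) 1) => h.hasDerivWithinAt_expCurve (hc'.affine ht₀ ht)
    (fun s hs => ⟨(hmem s hs).2.1, (hmem s hs).2.2.1⟩) hs
  have hlip : LipschitzOnWith (‖t - t₀‖₊ * K) (fun y => frameField Z ((t - t₀) • ξ, y)) S := by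
    have e : (fun y => frameField Z ((t - t₀) • ξ, y)) =
        fun y => (t - t₀) • frameField Z (ξ, y) := by
      funext y
      simp [frameField, Finset.smul_sum, smul_smul]
    rw [e]
    refine LipschitzOnWith.of_dist_le_mul fun x hx y hy => ?_
    rw [dist_smul₀, NNReal.coe_mul, mul_assoc, coe_nnnorm]
    exact mul_le_mul_of_nonneg_left (hK.dist_le_mul x hx y hy) (norm_nonneg _)
  have hmono : ∀ {f : ℝ → REuc N} {f' : REuc N} {s : ℝ}, s ∈ Ico (0 : ℝ) 1 →
      HasDerivWithinAt f f' (Icc 0 1) s → HasDerivWithinAt f f' (Ici s) s := fun hs hf =>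
    hf.mono_of_mem_nhdsWithin (Icc_mem_nhdsGE_of_mem hs)
  have key := ODE_solution_unique_of_mem_Icc_right (a := 0) (b := 1)
    (v := fun _ y => frameField Z ((t - t₀) • ξ, y)) (s := fun _ => S) (fun _ _ => hlip)
    (fun s hs => (hd s hs).continuousWithinAt)
    (fun s hs => hmono hs (hd s (Ico_subset_Icc_self hs)))
    (fun s hs => (hmem s (Ico_subset_Icc_self hs)).1.2.2)
    (fun s hs => (hd' s hs).continuousWithinAt)
    (fun s hs => hmono hs (hd' s (Ico_subset_Icc_self hs)))
    (fun s hs => (hmem s (Ico_subset_Icc_self hs)).2.2.2)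
    (by simp only [zero_mul, add_zero]; rw [← heq]) (⟨zero_le_one, le_rfl⟩ : (1 : ℝ) ∈ Icc (0 : ℝ) 1)
  have h1 := hmem 1 ⟨zero_le_one, le_rfl⟩
  simp only [one_mul, add_sub_cancel] at key h1
  exact φ.injOn h1.1.1 h1.2.1 key

/-- Uniqueness of integral curves. -/
theorem IsCarnotFrame.expCurve_unique [T2Space M] (hX : IsCarnotFrame F V X) {ξ : REuc N}
    {c c' : ℝ → M} (hc : IsExpCurve V X ξ c) (hc' : IsExpCurve V X ξ c') (heq : c 0 = c' 0)
    {t : ℝ} (ht : t ∈ Icc (0 : ℝ) 1) : c t = c' t := by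
  -- The set of times of agreement is open by local uniqueness and closed because `M` is Hausdorff.
  have key := isPreconnected_Icc.induction₂ (s := Icc (0 : ℝ) 1) (fun s t => c s = c' s ↔ c t = c' t)
    (fun s hs => ?_) (fun _ _ _ _ _ _ h1 h2 => h1.trans h2) (fun _ _ _ _ h => h.symm)
    (⟨le_rfl, zero_le_one⟩ : (0 : ℝ) ∈ Icc (0 : ℝ) 1) ht
  · exact key.1 heq
  · by_cases h : c s = c' s
    · filter_upwards [hX.eventually_eq_of_eq hc hc' hs h] with t ht
      exact iff_of_true h ht
    · filter_upwards [((hc.continuousOn s hs).prodMk (hc'.continuousOn s hs)).tendsto.eventually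
        (isClosed_diagonal.isOpen_compl.mem_nhds (x := (c s, c' s)) h)] with t ht
      exact iff_of_false h ht

theorem IsCarnotFrame.isExp_unique [T2Space M] (hX : IsCarnotFrame F V X) {ξ : REuc N} {u v v' : M}
    (h : IsExp V X u ξ v) (h' : IsExp V X u ξ v') : v = v' := by
  obtain ⟨c, hc, rfl, rfl⟩ := isExp_iff.1 h
  obtain ⟨c', hc', h0, rfl⟩ := isExp_iff.1 h'
  exact hX.expCurve_unique hc hc' h0.symm ⟨zero_le_one, le_rfl⟩

end ExpCurve

/-! ### Degrees and d_∞ in terms of componentwise bounds. -/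

section Homogeneous

variable {N : ℕ} (F : FiltrationDims N)

lemma FiltrationDims.one_le_deg (k : Fin N) : 1 ≤ F.deg k := by
  have hne : {m : ℕ | (k : ℕ) < F.dimH m}.Nonempty := ⟨F.depth, by
    rw [mem_ofPred_eq, F.dimH_depth]; exact k.2⟩
  have h1 : (k : ℕ) < F.dimH (F.deg k) := Nat.sInf_mem hne
  rcases Nat.eq_zero_or_pos (F.deg k) with h0 | h0
  · rw [h0, F.dimH_zero] at h1
    exact absurd h1 (Nat.not_lt_zero _)
  · exact h0

lemma hNorm_le_ofReal_iff {ξ : REuc N} {ε : ℝ} (hε : 0 ≤ ε) :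
    hNorm F ξ ≤ ENNReal.ofReal ε ↔ ∀ k, |ξ k| ≤ ε ^ F.deg k := by
  rw [hNorm, iSup_le_iff]
  refine forall_congr' fun k => ?_
  have hk : (0 : ℝ) < F.deg k := by exact_mod_cast F.one_le_deg k
  rw [ENNReal.ofReal_le_ofReal_iff hε, one_div, Real.rpow_inv_le_iff_of_pos (abs_nonneg _) hε hk,
    Real.rpow_natCast]

variable {M : Type*} [TopologicalSpace M] [ChartedSpace (REuc N) M]
  {V : Set M} {X : Fin N → (x : M) → TangentSpace (𝓡 N) x}

lemma IsNormalCoord.isExp {u v : M} {ξ : REuc N} (h : IsNormalCoord V X u v ξ) :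
    IsExp V X u ξ v := by
  obtain ⟨r, Φ, hΦ, hξ, rfl⟩ := h
  exact hΦ.isExp ξ hξ

variable {F}

lemma exists_isNormalCoord_of_dInf_lt {u v : M} {ε : ℝ} (hε : 0 ≤ ε)
    (h : dInf F V X u v < ENNReal.ofReal ε) :
    ∃ ξ, IsNormalCoord V X u v ξ ∧ ∀ k, |ξ k| ≤ ε ^ F.deg k := by
  obtain ⟨ξ, hξ⟩ := iInf_lt_iff.1 h
  obtain ⟨hn, hlt⟩ := iInf_lt_iff.1 hξ
  exact ⟨ξ, hn, (hNorm_le_ofReal_iff F hε).1 hlt.le⟩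

/-- Any tuple of normal coordinates bounds the infimum from above. Together with
`exists_isNormalCoord_of_dInf_lt` this is all that is used of d_∞, so the uniqueness of normal
coordinates is never needed. -/
lemma IsNormalCoord.dInf_le {u v : M} {ξ : REuc N} (h : IsNormalCoord V X u v ξ) {ε : ℝ}
    (hε : 0 ≤ ε) (hξ : ∀ k, |ξ k| ≤ ε ^ F.deg k) : dInf F V X u v ≤ ENNReal.ofReal ε :=
  (iInf₂_le ξ h).trans ((hNorm_le_ofReal_iff F hε).2 hξ)

end Homogeneous

/-! ### Normal charts and the local estimates on the manifold. -/

section LocalManifold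

variable {N : ℕ} {M : Type*} [TopologicalSpace M] [ChartedSpace (REuc N) M]
  [IsManifold (𝓡 N) ∞ M] {F : FiltrationDims N} {V : Set M}
  {X : Fin N → (x : M) → TangentSpace (𝓡 N) x} {Z : Fin N → REuc N → REuc N} {W : Set (REuc N)}

lemma LocalExp.contDiffAt_exp {p : REuc N} (L : LocalExp Z W p) {z : REuc N × REuc N}
    (hz : z ∈ L.chart.source) : ContDiffAt ℝ 1 L.exp z :=
  ContDiffAt.comp (f := L.Γ) z ((ContinuousMap.evalCLM ℝ (projIcc (0 : ℝ) 1 zero_le_one 1) :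
    UnitPath (REuc N) →L[ℝ] REuc N).contDiff.contDiffAt) (L.contDiffAt_Γ z hz)

lemma LocalExp.exp_mem {p : REuc N} (L : LocalExp Z W p) {z : REuc N × REuc N}
    (hz : z ∈ L.chart.source) : L.exp z ∈ W := L.mem z hz _

namespace IsChartFrame

variable {p : M} {C : ℝ} (h : IsChartFrame F V X p Z W C)
  (L : LocalExp Z W (extChartAt (𝓡 N) p p))
include h

lemma isExp_exp {z : REuc N × REuc N} (hz : z ∈ L.chart.source) :
    IsExp V X ((extChartAt (𝓡 N) p).symm z.1) z.2 ((extChartAt (𝓡 N) p).symm (L.exp z)) := by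
  refine ⟨fun t => (extChartAt (𝓡 N) p).symm ((L.Γ z).extend t), ?_, rfl,
    fun t _ => h.mapsTo _ (L.mem z hz _), fun t ht =>
      h.hasMFDerivWithinAt_symm (L.hasDeriv z hz t ht) (L.mem z hz _)⟩
  simp only [L.Γ_zero z hz]

omit [IsManifold (𝓡 N) ∞ M] in
lemma apply_symm {y : REuc N} (hy : y ∈ W) :
    extChartAt (𝓡 N) p ((extChartAt (𝓡 N) p).symm y) = y :=
  (extChartAt (𝓡 N) p).right_inv (h.subset_target hy)

omit [IsManifold (𝓡 N) ∞ M] in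
lemma symm_mem_source {y : REuc N} (hy : y ∈ W) :
    (extChartAt (𝓡 N) p).symm y ∈ (extChartAt (𝓡 N) p).source :=
  (extChartAt (𝓡 N) p).map_target (h.subset_target hy)

/-- A curve in `V` might leave the chart a priori. By uniqueness it coincides with the one built in
the chart. -/
lemma eq_exp_of_isExp [T2Space M] (hX : IsCarnotFrame F V X) {u v : M} {ξ : REuc N}
    (hu : u ∈ (extChartAt (𝓡 N) p).source) (hz : (extChartAt (𝓡 N) p u, ξ) ∈ L.chart.source)
    (huv : IsExp V X u ξ v) :
    v = (extChartAt (𝓡 N) p).symm (L.exp (extChartAt (𝓡 N) p u, ξ)) := by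
  have h1 := h.isExp_exp L hz
  simp only [(extChartAt (𝓡 N) p).left_inv hu] at h1
  exact hX.isExp_unique huv h1

/-- The slice of `L.chart` over `x`, read on the manifold. Its target is stated because the covering
property is checked on it. -/
lemma exists_isNormalChart {x : REuc N} (hx : x ∈ L.base) :
    ∃ Φ, IsNormalChart V X ((extChartAt (𝓡 N) p).symm x) L.radius Φ ∧
      (∀ ξ, Φ ξ = (extChartAt (𝓡 N) p).symm (L.exp (x, ξ))) ∧
      Φ.target = (extChartAt (𝓡 N) p).source ∩
        extChartAt (𝓡 N) p ⁻¹' {y | (x, y) ∈ L.chart.target} := by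
  have hsrc : ∀ {ξ}, ξ ∈ ball (0 : REuc N) L.radius → (x, ξ) ∈ L.chart.source := fun hξ => by
    rw [L.source_eq]; exact ⟨hx, hξ⟩
  have hchart : ∀ ξ, L.chart (x, ξ) = (x, L.exp (x, ξ)) := fun ξ => L.chart_apply _
  have hsymm : ∀ {y}, (x, y) ∈ L.chart.target → (L.chart.symm (x, y)).2 ∈ ball 0 L.radius ∧
      L.exp (x, (L.chart.symm (x, y)).2) = y := fun {y} hy => by
    have h1 := L.chart.map_target hy
    have h2 := (L.chart_apply _).symm.trans (L.chart.right_inv hy)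
    have h3 : (L.chart.symm (x, y)).1 = x := congrArg Prod.fst h2
    have h4 : L.exp (L.chart.symm (x, y)) = y := congrArg Prod.snd h2
    rw [L.source_eq] at h1
    refine ⟨h1.2, ?_⟩
    nth_rewrite 1 [← h3]
    exact h4
  let Φ : PartialDiffeomorph 𝓘(ℝ, REuc N) (𝓡 N) (REuc N) M 1 :=
    { toFun := fun ξ => (extChartAt (𝓡 N) p).symm (L.exp (x, ξ))
      invFun := fun v => (L.chart.symm (x, extChartAt (𝓡 N) p v)).2
      source := ball 0 L.radius
      target := (extChartAt (𝓡 N) p).source ∩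
        extChartAt (𝓡 N) p ⁻¹' {y | (x, y) ∈ L.chart.target}
      map_source' := fun ξ hξ => by
        have hW := L.exp_mem (hsrc hξ)
        refine ⟨h.symm_mem_source hW, ?_⟩
        rw [mem_preimage, h.apply_symm hW, mem_ofPred_eq, ← hchart]
        exact L.chart.map_source (hsrc hξ)
      map_target' := fun v hv => (hsymm hv.2).1
      left_inv' := fun ξ hξ => by
        rw [h.apply_symm (L.exp_mem (hsrc hξ)), ← hchart, L.chart.left_inv (hsrc hξ)]
      right_inv' := fun v hv => by
        rw [(hsymm hv.2).2, (extChartAt (𝓡 N) p).left_inv hv.1]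
      open_source := isOpen_ball
      open_target := isOpen_extChartAt_preimage' p
        (L.chart.open_target.preimage (Continuous.prodMk_right x))
      contMDiffOn_toFun := fun ξ hξ => by
        have h1 : ContDiffAt ℝ 1 (fun ξ => L.exp (x, ξ)) ξ :=
          (L.contDiffAt_exp (hsrc hξ)).comp ξ (contDiffAt_const.prodMk contDiffAt_id)
        have h2 := (contMDiffAt_chart_symm (p := p)
          (h.subset_target (L.exp_mem (hsrc hξ)))).of_le (m := 1) (by norm_cast)
        exact (ContMDiffAt.comp ξ h2 h1.contMDiffAt).contMDiffWithinAt
      contMDiffOn_invFun := fun v hv => by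
        have h1 : ContDiffAt ℝ 1 (fun y => (L.chart.symm (x, y)).2) (extChartAt (𝓡 N) p v) :=
          contDiffAt_snd.comp _ ((L.contDiffAt_symm _ hv.2).comp (extChartAt (𝓡 N) p v)
            (contDiffAt_const.prodMk contDiffAt_id))
        have h2 := (contMDiffAt_extChartAt' (I := 𝓡 N) (n := ∞) (x := p) (x' := v)
          (by rw [← extChartAt_source (𝓡 N)]; exact hv.1)).of_le (m := 1) (by norm_cast)
        exact (ContMDiffAt.comp v h1.contMDiffAt h2).contMDiffWithinAt }
  exact ⟨Φ, ⟨L.radius_pos, rfl, fun ξ hξ => h.isExp_exp L (hsrc hξ)⟩, fun _ => rfl, rfl⟩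

lemma isNormalCoord_exp {x ξ : REuc N} (hz : (x, ξ) ∈ L.chart.source) :
    IsNormalCoord V X ((extChartAt (𝓡 N) p).symm x) ((extChartAt (𝓡 N) p).symm (L.exp (x, ξ)))
      ξ := by
  rw [L.source_eq] at hz
  obtain ⟨Φ, hΦ, he, -⟩ := h.exists_isNormalChart L hz.1
  exact ⟨_, Φ, hΦ, hz.2, he ξ⟩

include L

lemma exists_normallyCovered : ∃ U ∈ 𝓝 p, IsCompact U ∧ NormallyCovered V X U := by
  -- The neighborhood is the image of a closed ball so small that every pair of its points lies in
  -- the target of `L.chart`; the slice over each of its points then covers it.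
  set x₀ := extChartAt (𝓡 N) p p
  obtain ⟨s₁, hs₁, hsT⟩ := Metric.isOpen_iff.1 L.chart.open_target _ L.mem_target
  obtain ⟨s₂, hs₂, hsW⟩ := Metric.isOpen_iff.1 (L.isOpen_base.inter h.graded.isOpen) x₀
    ⟨L.mem_base, h.mem⟩
  rw [← ball_prod_same] at hsT
  obtain ⟨s, hs, hss⟩ := exists_between (lt_min hs₁ hs₂)
  have hsub₁ : closedBall x₀ s ⊆ ball x₀ s₁ := closedBall_subset_ball (hss.trans_le (min_le_left _ _))
  have hsub₂ : closedBall x₀ s ⊆ L.base ∩ W :=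
    (closedBall_subset_ball (hss.trans_le (min_le_right _ _))).trans hsW
  have htgt : closedBall x₀ s ⊆ (extChartAt (𝓡 N) p).target :=
    fun y hy => h.subset_target (hsub₂ hy).2
  refine ⟨(extChartAt (𝓡 N) p).symm '' closedBall x₀ s, ?_,
    (isCompact_closedBall x₀ s).image_of_continuousOn
      ((continuousOn_extChartAt_symm p).mono htgt), ?_, ?_⟩
  · filter_upwards [extChartAt_source_mem_nhds (I := 𝓡 N) p,
      (continuousAt_extChartAt (I := 𝓡 N) p).preimage_mem_nhds (closedBall_mem_nhds x₀ hs)]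
      with v hv hv'
    exact ⟨_, hv', (extChartAt (𝓡 N) p).left_inv hv⟩
  · rintro _ ⟨y, hy, rfl⟩
    exact h.mapsTo y (hsub₂ hy).2
  · rintro _ ⟨x, hx, rfl⟩
    obtain ⟨Φ, hΦ, -, htarget⟩ := h.exists_isNormalChart L (hsub₂ hx).1
    refine ⟨_, Φ, hΦ, ?_⟩
    rw [← hΦ.source_eq]
    have h2 : Φ '' Φ.source = Φ.target := Φ.toPartialEquiv.image_source_eq_target
    rw [h2, htarget]
    rintro _ ⟨y, hy, rfl⟩
    refine ⟨h.symm_mem_source (hsub₂ hy).2, ?_⟩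
    rw [mem_preimage, h.apply_symm (hsub₂ hy).2]
    exact hsT ⟨hsub₁ hx, hsub₁ hy⟩

variable [T2Space M] (hX : IsCarnotFrame F V X)
include hX

/-- Only `u` has to be near `p`: smallness of the coordinates forces `w` and `v` into the chart,
where `exists_quasi_triangle` applies. -/
lemma exists_dInf_le : ∃ O ∈ 𝓝 p, ∃ C' > 0, ∃ ε₀ > 0, ∀ u ∈ O, ∀ w v ξ η, ∀ ε : ℝ, 0 < ε →
    ε ≤ ε₀ → (∀ k, |ξ k| ≤ ε ^ F.deg k) → (∀ k, |η k| ≤ ε ^ F.deg k) →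
    IsExp V X u ξ w → IsExp V X w η v → dInf F V X u v ≤ ENNReal.ofReal (C' * ε) := by
  obtain ⟨C', hC', ε₀, hε₀, s, hs, -, H⟩ := L.exists_quasi_triangle F.one_le_deg h.graded h.nonneg
  refine ⟨_, Filter.inter_mem (extChartAt_source_mem_nhds (I := 𝓡 N) p)
    ((continuousAt_extChartAt (I := 𝓡 N) p).preimage_mem_nhds (ball_mem_nhds _ hs)), C', hC', ε₀,
    hε₀, fun u hu w v ξ η ε hε hεε₀ hξ hη huw hwv => ?_⟩
  obtain ⟨h1, h2, ζ, h3, h4, h5⟩ := H _ hu.2 ξ η ε hε hεε₀ hξ hη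
  have hw := h.eq_exp_of_isExp L hX hu.1 h1 huw
  have hWw := L.exp_mem h1
  have hw1 : w ∈ (extChartAt (𝓡 N) p).source := by rw [hw]; exact h.symm_mem_source hWw
  have hw2 : extChartAt (𝓡 N) p w = L.exp (extChartAt (𝓡 N) p u, ξ) := by
    rw [hw, h.apply_symm hWw]
  have hv := h.eq_exp_of_isExp L hX hw1 (by rw [hw2]; exact h2) hwv
  rw [hw2, h5] at hv
  have h6 := h.isNormalCoord_exp L h3
  rw [← hv, (extChartAt (𝓡 N) p).left_inv hu.1] at h6
  exact h6.dInf_le (by positivity) h4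

lemma exists_isExp_mem {O : Set M} (hO : O ∈ 𝓝 p) : ∃ O' ∈ 𝓝 p, ∃ ε₀ > 0, ∀ u ∈ O', ∀ w ξ,
    (∀ k, |ξ k| ≤ ε₀) → IsExp V X u ξ w → w ∈ O := by
  have h1 : (extChartAt (𝓡 N) p).symm ⁻¹' O ∈ 𝓝 (extChartAt (𝓡 N) p p) := by
    refine (continuousAt_extChartAt_symm p).preimage_mem_nhds ?_
    rwa [extChartAt_to_inv]
  obtain ⟨s, hs, hsO⟩ := Metric.mem_nhds_iff.1 h1
  obtain ⟨s', hs', H⟩ := L.exists_ball_dist_lt hs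
  obtain ⟨ε₀, hε₀, hnorm⟩ := exists_norm_lt_of_abs_le N hs'
  refine ⟨_, Filter.inter_mem (extChartAt_source_mem_nhds (I := 𝓡 N) p)
    ((continuousAt_extChartAt (I := 𝓡 N) p).preimage_mem_nhds (ball_mem_nhds _ hs')), ε₀, hε₀,
    fun u hu w ξ hξ huw => ?_⟩
  obtain ⟨h2, h3⟩ := H _ hu.2 ξ (mem_ball_zero_iff.2 (hnorm ξ hξ))
  rw [h.eq_exp_of_isExp L hX hu.1 h2 huw]
  exact hsO (h3 1)

end IsChartFrame

end LocalManifold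

/-! ### Continuity of normal coordinates along integral curves of arbitrary length. -/

section FlowGerm

variable {N : ℕ} {M : Type*} [TopologicalSpace M] [ChartedSpace (REuc N) M]
  {V : Set M} {X : Fin N → (x : M) → TangentSpace (𝓡 N) x}

/-- Near `(u₀, ξ₀)`, the integral curves of `∑ ξ_i X_i` that start at `u` are, as far as they exist
up to the time `1`, at the time `t` at `f (u, ξ)` for a `C¹` map `f` with `f (u₀, ξ₀) = q`. -/
def HasFlowGerm (V : Set M) (X : Fin N → (x : M) → TangentSpace (𝓡 N) x) (u₀ : M) (ξ₀ : REuc N)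
    (t : ℝ) (q : M) : Prop :=
  ∃ f : REuc N × REuc N → M,
    ContMDiffAt 𝓘(ℝ, REuc N × REuc N) (𝓡 N) 1 f (extChartAt (𝓡 N) u₀ u₀, ξ₀) ∧
    f (extChartAt (𝓡 N) u₀ u₀, ξ₀) = q ∧
    ∀ᶠ z in 𝓝 (extChartAt (𝓡 N) u₀ u₀, ξ₀), ∀ c, IsExpCurve V X z.2 c →
      c 0 = (extChartAt (𝓡 N) u₀).symm z.1 → c t = f z

variable [IsManifold (𝓡 N) ∞ M] {F : FiltrationDims N}

lemma hasFlowGerm_zero (u₀ : M) (ξ₀ : REuc N) : HasFlowGerm V X u₀ ξ₀ 0 u₀ := by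
  refine ⟨fun z => (extChartAt (𝓡 N) u₀).symm z.1, ?_, extChartAt_to_inv u₀,
    Filter.Eventually.of_forall fun z c _ h => h⟩
  have h1 := (contMDiffAt_chart_symm (mem_extChartAt_target (I := 𝓡 N) u₀)).of_le (m := 1)
    (by norm_cast)
  exact ContMDiffAt.comp (extChartAt (𝓡 N) u₀ u₀, ξ₀) h1
    (contDiffAt_fst (𝕜 := ℝ) (E := REuc N) (F := REuc N)).contMDiffAt

lemma contMDiffAt_one_extChartAt {p q : M} (h : q ∈ (extChartAt (𝓡 N) p).source) :
    ContMDiffAt (𝓡 N) 𝓘(ℝ, REuc N) 1 (extChartAt (𝓡 N) p) q :=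
  (contMDiffAt_extChartAt' (n := ∞) (by rwa [extChartAt_source] at h)).of_le (by norm_cast)

lemma contMDiffAt_one_extChartAt_symm {p : M} {y : REuc N}
    (h : y ∈ (extChartAt (𝓡 N) p).target) :
    ContMDiffAt 𝓘(ℝ, REuc N) (𝓡 N) 1 (extChartAt (𝓡 N) p).symm y :=
  (contMDiffAt_chart_symm h).of_le (by norm_cast)

variable [T2Space M]

/-- The germ at time `s` is followed by the local exponential with parameter (t - s) ξ. The sign of
t - s is free, so the step also goes backwards. -/
lemma HasFlowGerm.step (hX : IsCarnotFrame F V X) {p : M} {Z : Fin N → REuc N → REuc N}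
    {W : Set (REuc N)} {C : ℝ} (h : IsChartFrame F V X p Z W C)
    (L : LocalExp Z W (extChartAt (𝓡 N) p p)) {u₀ : M} {ξ₀ : REuc N} {c₀ : ℝ → M}
    (hc₀ : IsExpCurve V X ξ₀ c₀) {s t : ℝ} (hs : s ∈ Icc (0 : ℝ) 1)
    (ht : t ∈ Icc (0 : ℝ) 1) (hsrc : c₀ s ∈ (extChartAt (𝓡 N) p).source)
    (hL : (extChartAt (𝓡 N) p (c₀ s), (t - s) • ξ₀) ∈ L.chart.source)
    (hf : HasFlowGerm V X u₀ ξ₀ s (c₀ s)) : HasFlowGerm V X u₀ ξ₀ t (c₀ t) := by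
  obtain ⟨f, hf1, hf2, hf3⟩ := hf
  set z₀ := (extChartAt (𝓡 N) u₀ u₀, ξ₀)
  let g : REuc N × REuc N → REuc N × REuc N := fun z => (extChartAt (𝓡 N) p (f z), (t - s) • z.2)
  have hg0 : g z₀ = (extChartAt (𝓡 N) p (c₀ s), (t - s) • ξ₀) := by simp only [g, hf2, z₀]
  have hg : ContDiffAt ℝ 1 g z₀ := by
    have h1 : ContMDiffAt (𝓡 N) 𝓘(ℝ, REuc N) 1 (extChartAt (𝓡 N) p) (f z₀) := by
      rw [hf2]; exact contMDiffAt_one_extChartAt hsrc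
    exact (ContMDiffAt.comp z₀ h1 hf1).contDiffAt.prodMk (contDiffAt_snd.const_smul (t - s))
  have hexp : ContMDiffAt 𝓘(ℝ, REuc N × REuc N) (𝓡 N) 1
      (fun z => (extChartAt (𝓡 N) p).symm (L.exp (g z))) z₀ := by
    have h1 : ContDiffAt ℝ 1 (fun z => L.exp (g z)) z₀ :=
      ContDiffAt.comp (g := L.exp) (f := g) z₀ (by rw [hg0]; exact L.contDiffAt_exp hL) hg
    have h2 := contMDiffAt_one_extChartAt_symm (N := N) (p := p) (y := L.exp (g z₀))
      (by rw [hg0]; exact h.subset_target (L.exp_mem hL))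
    exact ContMDiffAt.comp z₀ h2 h1.contMDiffAt
  refine ⟨_, hexp, ?_, ?_⟩
  · change (extChartAt (𝓡 N) p).symm (L.exp (g z₀)) = c₀ t
    rw [hg0]
    exact (h.eq_exp_of_isExp L hX hsrc hL (hc₀.isExp_affine hs ht)).symm
  · have h1 : ∀ᶠ z in 𝓝 z₀, f z ∈ (extChartAt (𝓡 N) p).source :=
      hf1.continuousAt.eventually ((isOpen_extChartAt_source p).mem_nhds (by rwa [hf2]))
    have h2 : ∀ᶠ z in 𝓝 z₀, g z ∈ L.chart.source :=
      hg.continuousAt.eventually (L.chart.open_source.mem_nhds (by rwa [hg0]))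
    filter_upwards [h1, h2, hf3] with z h1 h2 h3 c hc hc0
    have h4 := h3 c hc hc0
    have h5 := hc.isExp_affine hs ht
    rw [h4] at h5
    exact h.eq_exp_of_isExp L hX h1 h2 h5

lemma HasFlowGerm.eventually_iff (hX : IsCarnotFrame F V X) {u₀ : M} {ξ₀ : REuc N} {c₀ : ℝ → M}
    (hc₀ : IsExpCurve V X ξ₀ c₀) {s : ℝ} (hs : s ∈ Icc (0 : ℝ) 1) :
    ∀ᶠ t in 𝓝[Icc 0 1] s,
      (HasFlowGerm V X u₀ ξ₀ s (c₀ s) → HasFlowGerm V X u₀ ξ₀ t (c₀ t)) ∧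
      (HasFlowGerm V X u₀ ξ₀ t (c₀ t) → HasFlowGerm V X u₀ ξ₀ s (c₀ s)) := by
  obtain ⟨Z, W, C, h⟩ := exists_isChartFrame hX (hc₀.mem s hs)
  obtain ⟨L⟩ := exists_localExp h.graded.isOpen h.graded.contDiff h.graded.linearIndependent h.mem
  set φ := extChartAt (𝓡 N) (c₀ s)
  have hmem : (φ (c₀ s), (0 : REuc N)) ∈ L.chart.source := by
    rw [L.source_eq]; exact ⟨L.mem_base, mem_ball_self L.radius_pos⟩
  have hc := hc₀.continuousOn s hs
  have hφ : Filter.Tendsto (fun t => φ (c₀ t)) (𝓝[Icc 0 1] s) (𝓝 (φ (c₀ s))) :=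
    (continuousAt_extChartAt (I := 𝓡 N) (c₀ s)).tendsto.comp hc
  have hid : Filter.Tendsto (fun t : ℝ => t) (𝓝[Icc 0 1] s) (𝓝 s) := nhdsWithin_le_nhds
  have h1 : Filter.Tendsto (fun t => (φ (c₀ s), (t - s) • ξ₀)) (𝓝[Icc 0 1] s)
      (𝓝 (φ (c₀ s), 0)) := by
    refine tendsto_const_nhds.prodMk_nhds ?_
    simpa using (hid.sub_const s).smul_const ξ₀
  have h2 : Filter.Tendsto (fun t => (φ (c₀ t), (s - t) • ξ₀)) (𝓝[Icc 0 1] s)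
      (𝓝 (φ (c₀ s), 0)) := by
    refine hφ.prodMk_nhds ?_
    simpa using (hid.const_sub s).smul_const ξ₀
  filter_upwards [h1.eventually (L.chart.open_source.mem_nhds hmem),
    h2.eventually (L.chart.open_source.mem_nhds hmem),
    hc.eventually (extChartAt_source_mem_nhds (I := 𝓡 N) (c₀ s)), self_mem_nhdsWithin]
    with t h1 h2 h3 ht
  exact ⟨HasFlowGerm.step hX h L hc₀ hs ht (mem_extChartAt_source _) h1,
    HasFlowGerm.step hX h L hc₀ ht hs h3 h2⟩

/-- Having a germ passes between neighboring times in both directions and holds at time 0, so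
connectedness of [0, 1] carries it to time 1. -/
theorem hasFlowGerm_one (hX : IsCarnotFrame F V X) {u₀ v₀ : M} {ξ₀ : REuc N}
    (h : IsExp V X u₀ ξ₀ v₀) : HasFlowGerm V X u₀ ξ₀ 1 v₀ := by
  obtain ⟨c₀, hc₀, rfl, rfl⟩ := isExp_iff.1 h
  exact isPreconnected_Icc.induction₂' (s := Icc (0 : ℝ) 1)
    (fun s t => HasFlowGerm V X (c₀ 0) ξ₀ s (c₀ s) → HasFlowGerm V X (c₀ 0) ξ₀ t (c₀ t))
    (fun s hs => HasFlowGerm.eventually_iff hX hc₀ hs)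
    (fun _ _ _ _ _ _ h1 h2 h => h2 (h1 h)) ⟨le_rfl, zero_le_one⟩ ⟨zero_le_one, le_rfl⟩
    (hasFlowGerm_zero _ _)

/-- The normal coordinates `ξ` of `v` with respect to `u` depend on `(u, v)` continuously, as long
as the domains of the normal charts do not shrink. -/
theorem IsNormalChart.eventually_exists (hX : IsCarnotFrame F V X) {u₀ : M} {r₀ : ℝ}
    {Φ₀ : PartialDiffeomorph 𝓘(ℝ, REuc N) (𝓡 N) (REuc N) M 1} (hΦ₀ : IsNormalChart V X u₀ r₀ Φ₀)
    {ξ₀ : REuc N} (hξ₀ : ξ₀ ∈ ball 0 r₀) {R : ℝ} (hR : ‖ξ₀‖ < R) :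
    ∀ᶠ z : M × M in 𝓝 (u₀, Φ₀ ξ₀), ∀ r Φ, IsNormalChart V X z.1 r Φ → R ≤ r →
      ∃ ξ ∈ ball (0 : REuc N) R, Φ ξ = z.2 := by
  obtain ⟨f, hf1, hf2, hf3⟩ := hasFlowGerm_one hX (hΦ₀.isExp ξ₀ hξ₀)
  set v₀ := Φ₀ ξ₀
  set φ := extChartAt (𝓡 N) u₀
  set ψ := extChartAt (𝓡 N) v₀
  set z₀ := (φ u₀, ξ₀)
  let k : REuc N × REuc N → REuc N := fun z => ψ (f z)
  have hk : ContDiffAt ℝ 1 k z₀ := by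
    have h1 : ContMDiffAt (𝓡 N) 𝓘(ℝ, REuc N) 1 ψ (f z₀) := by
      rw [hf2]; exact contMDiffAt_one_extChartAt (mem_extChartAt_source v₀)
    exact (ContMDiffAt.comp z₀ h1 hf1).contDiffAt
  have hsrc₀ : ξ₀ ∈ Φ₀.source := by rwa [hΦ₀.source_eq]
  have htgt₀ : v₀ ∈ Φ₀.target := Φ₀.map_source' hsrc₀
  have hψv : ψ.symm (ψ v₀) = v₀ := extChartAt_to_inv v₀
  have hk0 : k z₀ = ψ v₀ := by simp only [k, hf2]
  -- a left inverse of the partial derivative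
  let g : REuc N → REuc N := fun y => Φ₀.invFun (ψ.symm y)
  have hg : DifferentiableAt ℝ g (k z₀) := by
    have h1 : ContMDiffAt (𝓡 N) 𝓘(ℝ, REuc N) 1 Φ₀.invFun (ψ.symm (k z₀)) := by
      rw [hk0, hψv]
      exact (Φ₀.contMDiffOn_invFun v₀ htgt₀).contMDiffAt (Φ₀.open_target.mem_nhds htgt₀)
    have h2 : ContMDiffAt 𝓘(ℝ, REuc N) (𝓡 N) 1 ψ.symm (k z₀) := by
      rw [hk0]; exact contMDiffAt_one_extChartAt_symm (mem_extChartAt_target v₀)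
    exact (ContMDiffAt.comp (k z₀) h1 h2).contDiffAt.differentiableAt one_ne_zero
  have hgk : ∀ᶠ ξ in 𝓝 ξ₀, g (k (φ u₀, ξ)) = ξ := by
    have hcont : Filter.Tendsto (fun ξ => (φ u₀, ξ)) (𝓝 ξ₀) (𝓝 z₀) :=
      (Continuous.prodMk_right (φ u₀)).continuousAt
    have h1 : ∀ᶠ ξ in 𝓝 ξ₀, f (φ u₀, ξ) ∈ ψ.source :=
      (hf1.continuousAt.tendsto.comp hcont).eventually
        ((isOpen_extChartAt_source v₀).mem_nhds (by rw [hf2]; exact mem_extChartAt_source v₀))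
    filter_upwards [hcont.eventually hf3, isOpen_ball.mem_nhds hξ₀, h1] with ξ h1 h2 h3
    obtain ⟨c, hc, hc0, hc1⟩ := isExp_iff.1 (hΦ₀.isExp ξ h2)
    have h4 := h1 c hc (hc0.trans (extChartAt_to_inv u₀).symm)
    simp only [g, k]
    rw [ψ.left_inv h3, ← h4, hc1]
    exact Φ₀.left_inv' (by rwa [hΦ₀.source_eq])
  have hD := hk.hasStrictFDerivAt one_ne_zero
  set D := fderiv ℝ k z₀
  -- The inverse of `Φ₀` is differentiable and undoes ξ ↦ k (φ u₀, ξ) near `ξ₀`, so the partial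
  -- derivative in ξ is injective.
  have hinj : ∀ b : REuc N, D (0, b) = 0 → b = 0 := fun b hb => by
    have h1 : HasFDerivAt (fun ξ : REuc N => (φ u₀, ξ)) (ContinuousLinearMap.inr ℝ _ _) ξ₀ :=
      hasFDerivAt_prodMk_right _ _
    have h2 := (HasFDerivAt.comp (g := g) (f := fun ξ => k (φ u₀, ξ)) ξ₀ hg.hasFDerivAt (hD.hasFDerivAt.comp ξ₀ h1)).unique
      ((hasFDerivAt_id ξ₀).congr_of_eventuallyEq hgk)
    have h3 := congrArg (fun T : REuc N →L[ℝ] REuc N => T b) h2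
    simpa [hb] using h3.symm
  have hG : HasStrictFDerivAt (fun z => (z.1, k z)) ((ContinuousLinearMap.fst ℝ _ _).prod D) z₀ :=
    hasStrictFDerivAt_fst.prodMk hD
  -- (a, b) ↦ (a, D (a, b)) is injective, hence surjective in finite dimension. So z ↦ (z.1, k z)
  -- maps neighborhoods of `z₀` onto neighborhoods: every nearby pair (u, v) is reached by some ξ
  -- near `ξ₀`.
  have hmap := hG.map_nhds_eq_of_surj (by
    refine LinearMap.range_eq_top.2 (LinearMap.injective_iff_surjective.1 ?_)
    refine (injective_iff_map_eq_zero _).2 ?_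
    rintro ⟨a, b⟩ hab
    have h1 : a = 0 := congrArg Prod.fst hab
    have h2 : D (a, b) = 0 := congrArg Prod.snd hab
    subst h1
    rw [hinj b h2]
    rfl)
  have hz₀ : ∀ᶠ z in 𝓝 z₀, (∀ c, IsExpCurve V X z.2 c → c 0 = φ.symm z.1 → c 1 = f z) ∧
      z.2 ∈ ball (0 : REuc N) R ∧ f z ∈ ψ.source :=
    hf3.and ((continuous_snd.continuousAt.eventually
      (isOpen_ball.mem_nhds (mem_ball_zero_iff.2 hR))).and
      (hf1.continuousAt.eventually
        ((isOpen_extChartAt_source v₀).mem_nhds (by rw [hf2]; exact mem_extChartAt_source v₀))))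
  have himage := Filter.image_mem_map hz₀ (m := fun z => (z.1, k z))
  rw [hmap, hk0] at himage
  have htend : Filter.Tendsto (fun z : M × M => (φ z.1, ψ z.2)) (𝓝 (u₀, v₀))
      (𝓝 (φ u₀, ψ v₀)) :=
    (ContinuousAt.comp (f := Prod.fst) (x := (u₀, v₀)) (continuousAt_extChartAt (I := 𝓡 N) u₀)
      continuous_fst.continuousAt).prodMk_nhds
      (ContinuousAt.comp (f := Prod.snd) (x := (u₀, v₀)) (continuousAt_extChartAt (I := 𝓡 N) v₀)
        continuous_snd.continuousAt)
  filter_upwards [htend.eventually himage,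
    continuous_fst.continuousAt.eventually (extChartAt_source_mem_nhds (I := 𝓡 N) u₀),
    continuous_snd.continuousAt.eventually (extChartAt_source_mem_nhds (I := 𝓡 N) v₀)]
    with z hz hz1 hz2 r Φ hΦ hRr
  obtain ⟨z', ⟨h1, h2, h3⟩, h4⟩ := hz
  have h5 : z'.1 = φ z.1 := congrArg Prod.fst h4
  have h6 : f z' = z.2 := ψ.injOn h3 hz2 (congrArg Prod.snd h4)
  -- The germ says nothing about the existence of curves. Here R ≤ r supplies the curve, since the
  -- chart at `z.1` is defined at `z'.2`.
  obtain ⟨c, hc, hc0, hc1⟩ := isExp_iff.1 (hΦ.isExp z'.2 (ball_subset_ball hRr h2))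
  refine ⟨z'.2, h2, ?_⟩
  rw [← hc1, ← h6]
  exact h1 c hc (by rw [hc0, h5, φ.left_inv hz1])

end FlowGerm

/-! ### Uniform constants on compact sets and the two estimates. -/

section Compact

/-- On a compact set the constants of local estimates can be chosen uniformly. -/
lemma IsCompact.exists_uniform_constants {M : Type*} [TopologicalSpace M] {U : Set M}
    (hU : IsCompact U) {P : M → ℝ → ℝ → Prop}
    (hmono : ∀ u ε C C', 0 < ε → C ≤ C' → P u ε C → P u ε C')
    (hloc : ∀ p ∈ U, ∃ O ∈ 𝓝 p, ∃ C > 0, ∃ ε₀ > 0, ∀ u ∈ O, ∀ ε, 0 < ε → ε ≤ ε₀ → P u ε C) :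
    ∃ C > 0, ∃ ε₀ > 0, ∀ u ∈ U, ∀ ε, 0 < ε → ε ≤ ε₀ → P u ε C := by
  refine hU.induction_on (p := fun s => ∃ C > 0, ∃ ε₀ > 0, ∀ u ∈ s, ∀ ε, 0 < ε → ε ≤ ε₀ → P u ε C)
    ⟨1, one_pos, 1, one_pos, fun u hu => hu.elim⟩ ?_ ?_ fun p hp => ?_
  · rintro s t hst ⟨C, hC, ε₀, hε₀, h⟩
    exact ⟨C, hC, ε₀, hε₀, fun u hu => h u (hst hu)⟩
  · rintro s t ⟨C, hC, ε₀, hε₀, h⟩ ⟨C', hC', ε₀', hε₀', h'⟩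
    refine ⟨max C C', lt_max_of_lt_left hC, min ε₀ ε₀', lt_min hε₀ hε₀', fun u hu ε hε hle => ?_⟩
    rcases hu with hu | hu
    · exact hmono _ _ _ _ hε (le_max_left _ _) (h u hu ε hε (hle.trans (min_le_left _ _)))
    · exact hmono _ _ _ _ hε (le_max_right _ _) (h' u hu ε hε (hle.trans (min_le_right _ _)))
  · obtain ⟨O, hO, h⟩ := hloc p hp
    exact ⟨O, mem_nhdsWithin_of_mem_nhds hO, h⟩

variable {N : ℕ} {M : Type*} [TopologicalSpace M] [T2Space M] [ChartedSpace (REuc N) M]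
  [IsManifold (𝓡 N) ∞ M] {F : FiltrationDims N} {V : Set M}
  {X : Fin N → (x : M) → TangentSpace (𝓡 N) x}

namespace IsCarnotFrame

variable (hX : IsCarnotFrame F V X)
include hX

omit [T2Space M] in
lemma exists_isChartFrame_localExp {p : M} (hp : p ∈ V) :
    ∃ Z W C, IsChartFrame F V X p Z W C ∧ Nonempty (LocalExp Z W (extChartAt (𝓡 N) p p)) := by
  obtain ⟨Z, W, C, h⟩ := exists_isChartFrame hX hp
  exact ⟨Z, W, C, h,
    exists_localExp h.graded.isOpen h.graded.contDiff h.graded.linearIndependent h.mem⟩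

omit [T2Space M] in
theorem exists_normallyCovered {p : M} (hp : p ∈ V) :
    ∃ U ∈ 𝓝 p, IsCompact U ∧ NormallyCovered V X U := by
  obtain ⟨Z, W, C, h, ⟨L⟩⟩ := hX.exists_isChartFrame_localExp hp
  exact h.exists_normallyCovered L

variable {U : Set M} (hU : IsCompact U) (hUV : U ⊆ V)
include hU hUV

theorem exists_dInf_le : ∃ C > 0, ∃ ε₀ > 0, ∀ u ∈ U, ∀ ε : ℝ, 0 < ε → ε ≤ ε₀ → ∀ (w v : M) (ξ η : REuc N),
    (∀ k, |ξ k| ≤ ε ^ F.deg k) → (∀ k, |η k| ≤ ε ^ F.deg k) →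
    IsExp V X u ξ w → IsExp V X w η v → dInf F V X u v ≤ ENNReal.ofReal (C * ε) := by
  refine hU.exists_uniform_constants (P := fun u ε C => ∀ (w v : M) (ξ η : REuc N),
    (∀ k, |ξ k| ≤ ε ^ F.deg k) → (∀ k, |η k| ≤ ε ^ F.deg k) →
    IsExp V X u ξ w → IsExp V X w η v → dInf F V X u v ≤ ENNReal.ofReal (C * ε))
    (fun u ε C C' hε hCC' h w v ξ η hξ hη h1 h2 => (h w v ξ η hξ hη h1 h2).trans
      (ENNReal.ofReal_le_ofReal (mul_le_mul_of_nonneg_right hCC' hε.le))) fun p hp => ?_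
  obtain ⟨Z, W, C, h, ⟨L⟩⟩ := hX.exists_isChartFrame_localExp (hUV hp)
  obtain ⟨O, hO, C', hC', ε₀, hε₀, H⟩ := h.exists_dInf_le L hX
  exact ⟨O, hO, C', hC', ε₀, hε₀, fun u hu ε hε hle w v ξ η => H u hu w v ξ η ε hε hle⟩

theorem exists_dInf_endpoints_le : ∃ C > 0, ∃ ε₀ > 0, ∀ u ∈ U, ∀ ε : ℝ, 0 < ε → ε ≤ ε₀ →
    ∀ (v w : M) (ξ η : REuc N), (∀ k, |ξ k| ≤ ε ^ F.deg k) → (∀ k, |η k| ≤ ε ^ F.deg k) →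
    IsExp V X u ξ v → IsExp V X u η w → dInf F V X v w ≤ ENNReal.ofReal (C * ε) := by
  refine hU.exists_uniform_constants (P := fun u ε C => ∀ (v w : M) (ξ η : REuc N),
    (∀ k, |ξ k| ≤ ε ^ F.deg k) → (∀ k, |η k| ≤ ε ^ F.deg k) →
    IsExp V X u ξ v → IsExp V X u η w → dInf F V X v w ≤ ENNReal.ofReal (C * ε))
    (fun u ε C C' hε hCC' h w v ξ η hξ hη h1 h2 => (h w v ξ η hξ hη h1 h2).trans
      (ENNReal.ofReal_le_ofReal (mul_le_mul_of_nonneg_right hCC' hε.le))) fun p hp => ?_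
  obtain ⟨Z, W, C, h, ⟨L⟩⟩ := hX.exists_isChartFrame_localExp (hUV hp)
  obtain ⟨O, hO, C', hC', ε₀, hε₀, H⟩ := h.exists_dInf_le L hX
  -- Reversing the first curve gives w = exp η (exp (-ξ) v). The estimate is then based at `v`
  -- instead of `u`, so `v` must be kept in `O`.
  obtain ⟨O', hO', ε₁, hε₁, H'⟩ := h.exists_isExp_mem L hX hO
  refine ⟨O', hO', C', hC', min ε₀ (min ε₁ 1), lt_min hε₀ (lt_min hε₁ one_pos),
    fun u hu ε hε hle v w ξ η hξ hη huv huw => ?_⟩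
  have hle1 : ε ≤ 1 := hle.trans ((min_le_right _ _).trans (min_le_right _ _))
  have hξ' : ∀ k, |ξ k| ≤ ε₁ := fun k =>
    (hξ k).trans ((pow_le_of_le_one hε.le hle1 (Nat.one_le_iff_ne_zero.1 (F.one_le_deg k))).trans
      (hle.trans ((min_le_right _ _).trans (min_le_left _ _))))
  exact H v (H' u hu v ξ hξ' huv) u w (-ξ) η ε hε (hle.trans (min_le_left _ _))
    (fun k => by simpa using hξ k) hη huv.symm huw

theorem exists_dInfDiam_box_le : ∃ L ε₀ : ℝ≥0, 0 < ε₀ ∧ ∀ u ∈ U, ∀ ε : ℝ≥0, 0 < ε → ε ≤ ε₀ →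
    dInfDiam F V X (Box F V X u ε) ≤ L * ε := by
  obtain ⟨C, hC, ε₀, hε₀, H⟩ := hX.exists_dInf_endpoints_le hU hUV
  lift C to ℝ≥0 using hC.le
  lift ε₀ to ℝ≥0 using hε₀.le
  refine ⟨C, ε₀, by exact_mod_cast hε₀, fun u hu ε hε hle => ?_⟩
  refine iSup₂_le fun v hv => iSup₂_le fun w hw => ?_
  have hcoord : ∀ y ∈ Box F V X u ε, ∃ ξ, IsNormalCoord V X u y ξ ∧
      ∀ k, |ξ k| ≤ (ε : ℝ) ^ F.deg k := fun y hy =>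
    exists_isNormalCoord_of_dInf_lt ε.coe_nonneg (by rwa [ENNReal.ofReal_coe_nnreal])
  obtain ⟨ξ, hξ, hξ'⟩ := hcoord v hv
  obtain ⟨η, hη, hη'⟩ := hcoord w hw
  have := H u hu ε (by exact_mod_cast hε) (by exact_mod_cast hle) v w ξ η hξ' hη' hξ.isExp hη.isExp
  rwa [← NNReal.coe_mul, ENNReal.ofReal_coe_nnreal, ENNReal.coe_mul] at this

-- The radii of the normal charts may vary wildly with the base point, so boundedness is proved near
-- each pair (u₀, v₀) and extended by compactness of U × U.
omit hUV in
theorem exists_dInf_le_of_normallyCovered (hcov : NormallyCovered V X U) :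
    ∃ B : ℝ≥0, ∀ u ∈ U, ∀ v ∈ U, dInf F V X u v ≤ B := by
  suffices h : ∃ B : ℝ≥0, ∀ z ∈ U ×ˢ U, dInf F V X z.1 z.2 ≤ B by
    obtain ⟨B, hB⟩ := h
    exact ⟨B, fun u hu v hv => hB (u, v) ⟨hu, hv⟩⟩
  refine (hU.prod hU).induction_on (p := fun s => ∃ B : ℝ≥0, ∀ z ∈ s, dInf F V X z.1 z.2 ≤ B)
    ⟨0, fun z hz => hz.elim⟩ ?_ ?_ ?_
  · rintro s t hst ⟨B, hB⟩
    exact ⟨B, fun z hz => hB z (hst hz)⟩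
  · rintro s t ⟨B, hB⟩ ⟨B', hB'⟩
    refine ⟨max B B', fun z hz => ?_⟩
    rcases hz with hz | hz
    · exact (hB z hz).trans (by exact_mod_cast le_max_left B B')
    · exact (hB' z hz).trans (by exact_mod_cast le_max_right B B')
  · rintro ⟨u₀, v₀⟩ ⟨hu₀, hv₀⟩
    obtain ⟨r₀, Φ₀, hΦ₀, hsub⟩ := hcov.2 u₀ hu₀
    obtain ⟨ξ₀, hξ₀, rfl⟩ := hsub hv₀
    have hev := hΦ₀.eventually_exists hX hξ₀ (lt_add_one ‖ξ₀‖)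
    set R := ‖ξ₀‖ + 1
    have hR : 1 ≤ R := le_add_of_nonneg_left (norm_nonneg _)
    refine ⟨_, Filter.inter_mem (mem_nhdsWithin_of_mem_nhds hev) self_mem_nhdsWithin, R.toNNReal,
      ?_⟩
    rintro ⟨u, v⟩ ⟨hz, hu, hv⟩
    obtain ⟨r, Φ, hΦ, hsub'⟩ := hcov.2 u hu
    obtain ⟨ξ, hξr, hξR, hξv⟩ : ∃ ξ ∈ ball (0 : REuc N) r, ξ ∈ ball (0 : REuc N) R ∧ Φ ξ = v := by
      -- A chart of radius at least `R` contains coordinates of `v` in the `R`-ball by continuity;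
      -- in a smaller chart all coordinates are below `R` anyway.
      rcases le_total R r with hRr | hrR
      · obtain ⟨ξ, hξ, hξv⟩ := hz r Φ hΦ hRr
        exact ⟨ξ, ball_subset_ball hRr hξ, hξ, hξv⟩
      · obtain ⟨ξ, hξ, hξv⟩ := hsub' hv
        exact ⟨ξ, hξ, ball_subset_ball hrR hξ, hξv⟩
    refine IsNormalCoord.dInf_le ⟨r, Φ, hΦ, hξr, hξv⟩ (zero_le_one.trans hR) fun k => ?_
    calc |ξ k| ≤ ‖ξ‖ := PiLp.norm_apply_le ξ k
      _ ≤ R := (mem_ball_zero_iff.1 hξR).le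
      _ ≤ R ^ F.deg k := le_self_pow₀ hR (Nat.one_le_iff_ne_zero.1 (F.one_le_deg k))

omit hUV in
theorem exists_generalized_triangle (hcov : NormallyCovered V X U) :
    ∃ Q : ℝ≥0, ∀ u ∈ U, ∀ w ∈ U, ∀ v ∈ U,
      dInf F V X u v ≤ Q * (dInf F V X u w + dInf F V X w v) := by
  obtain ⟨C, hC, ε₀, hε₀, H⟩ := hX.exists_dInf_le hU hcov.1
  obtain ⟨B, hB⟩ := hX.exists_dInf_le_of_normallyCovered hU hcov
  lift C to ℝ≥0 using hC.le
  lift ε₀ to ℝ≥0 using hε₀.le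
  have hε₀' : ε₀ ≠ 0 := by rintro rfl; exact lt_irrefl _ hε₀
  -- `C` serves when the sum of distances is below `ε₀`; otherwise d_∞ ≤ B ≤ (B / ε₀) S.
  refine ⟨C + B / ε₀, fun u hu w hw v hv => ?_⟩
  set S := dInf F V X u w + dInf F V X w v
  rcases lt_or_ge S ε₀ with h | h
  · have hle : dInf F V X u v ≤ C * S := by
      obtain ⟨s, hs⟩ : ∃ s : ℝ≥0, S = s := ⟨_, (ENNReal.coe_toNNReal h.ne_top).symm⟩
      rw [hs, ENNReal.coe_lt_coe] at h
      rw [hs]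
      -- Coordinates are extracted from a strict bound on the infimum, and `H` needs ε > 0, so the
      -- estimate is shown for ε > s and passed to the limit; this includes s = 0.
      have h1 : ∀ᶠ ε : ℝ≥0 in 𝓝[>] s, dInf F V X u v ≤ ((C * ε : ℝ≥0) : ℝ≥0∞) := by
        filter_upwards [Ioo_mem_nhdsGT h] with ε hε
        have hlt : (s : ℝ≥0∞) < ENNReal.ofReal ε := by
          rw [ENNReal.ofReal_coe_nnreal]; exact_mod_cast hε.1
        obtain ⟨ξ, hξ, hξ'⟩ := exists_isNormalCoord_of_dInf_lt ε.coe_nonneg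
          (((le_self_add : dInf F V X u w ≤ S).trans hs.le).trans_lt hlt)
        obtain ⟨η, hη, hη'⟩ := exists_isNormalCoord_of_dInf_lt ε.coe_nonneg
          (((le_add_self : dInf F V X w v ≤ S).trans hs.le).trans_lt hlt)
        have := H u hu ε (by exact_mod_cast pos_of_gt hε.1) (by exact_mod_cast hε.2.le)
          w v ξ η hξ' hη' hξ.isExp hη.isExp
        rwa [← NNReal.coe_mul, ENNReal.ofReal_coe_nnreal] at this
      have h2 : Filter.Tendsto (fun ε : ℝ≥0 => ((C * ε : ℝ≥0) : ℝ≥0∞)) (𝓝[>] s)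
          (𝓝 ((C * s : ℝ≥0) : ℝ≥0∞)) :=
        (ENNReal.continuous_coe.comp (continuous_const_mul C)).continuousAt.tendsto.mono_left
          nhdsWithin_le_nhds
      have : (𝓝[>] s).NeBot := nhdsGT_neBot_of_exists_gt ⟨ε₀, h⟩
      have h3 := ge_of_tendsto h2 h1
      rwa [ENNReal.coe_mul] at h3
    refine hle.trans (mul_le_mul_left ?_ _)
    exact_mod_cast le_self_add
  · calc dInf F V X u v ≤ B := hB u hu v hv
      _ = ((B / ε₀ : ℝ≥0) : ℝ≥0∞) * ε₀ := by
        rw [← ENNReal.coe_mul, div_mul_cancel₀ B hε₀']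
      _ ≤ _ := by
        refine mul_le_mul' ?_ h
        exact_mod_cast le_add_self

end IsCarnotFrame

end Compact

theorem mainTheorem5 {N : ℕ} {M : Type*} [TopologicalSpace M] [T2Space M]
    [ChartedSpace (REuc N) M] [IsManifold (𝓡 N) ∞ M]
    (F : FiltrationDims N) (V : Set M) (X : Fin N → (x : M) → TangentSpace (𝓡 N) x)
    (hX : IsCarnotFrame F V X) :
    (∀ p ∈ V, ∃ U ∈ 𝓝 p, IsCompact U ∧ NormallyCovered V X U) ∧
    ∀ U : Set M, IsCompact U → NormallyCovered V X U →
      (∃ L ε₀ : ℝ≥0, 0 < ε₀ ∧ ∀ u ∈ U, ∀ ε : ℝ≥0, 0 < ε → ε ≤ ε₀ →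
        dInfDiam F V X (Box F V X u ε) ≤ L * ε) ∧
      (∃ Q : ℝ≥0, ∀ u ∈ U, ∀ w ∈ U, ∀ v ∈ U,
        dInf F V X u v ≤ Q * (dInf F V X u w + dInf F V X w v)) :=
  ⟨fun _ hp => hX.exists_normallyCovered hp, fun _ hU hcov =>
    ⟨hX.exists_dInfDiam_box_le hU hcov.1, hX.exists_generalized_triangle hU hcov⟩⟩
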